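/- Let $p$ be an odd prime, let $E_p$ be the elliptic curve $y^2 = x^3 - 5px$ over $\mathbb{Q}$, and let $K=\mathbb{Q}(i)$. For an elliptic curve $E: y^2=x^3+ax^2+bx$ over $\mathbb{Q}$ and $m \in \mathbb{Q}^\times$, write $E[m]: y^2=x^3+max^2+m^2bx$ for its $m$-twist. Then $E_p[-1]=E_p$; in particular $E_p$ and $E_p[-1]$ are isomorphic over $K$. The groups $E_p(\mathbb{Q})$ and $E_p(K)$ are finitely generated, and their ranks satisfy $$\operatorname{rank} E_p(K) = 2\cdot \operatorname{rank} E_p(\mathbb{Q}).$$ Moreover: (i) If $p\equiv 7 \pmod{40}$ or $p \equiv 23 \pmod{40}$, then $\operatorname{rank} E_p(K)=0$. (ii) If $p=40k_1+3$ for some $k_1\in\mathbb{Z}$ such that $5k_1+1$ is a perfect square, or $p=40k_2+27$ for some $k_2\in\mathbb{Z}$ such that $5k_2+4$ is a perfect square, then $\operatorname{rank} E_p(K)=2$. (iii) If $p=40k_3+11$ for some $k_3\in\mathbb{Z}$ such that $160k_3+49$ is a perfect square, or $p=40k_4+19$ for some $k_4\in\mathbb{Z}$ such that $160k_4+81$ is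 a perfect square, then $\operatorname{rank} E_p(K)\ge 2$. -/

import Mathlib

namespace FiveP

/-- The field `ℚ(i)`, as a subfield of `ℂ`. -/
abbrev QI : Type := IntermediateField.adjoin ℚ ({Complex.I} : Set ℂ)

/-- The curve `E_p : y² = x³ - 5 p x` over `ℚ`. -/
def curve (p : ℕ) : WeierstrassCurve ℚ where
  a₁ := 0
  a₂ := 0
  a₃ := 0
  a₄ := -5 * (p : ℚ)
  a₆ := 0

/-- The quadratic twist by `m` of a Weierstrass curve over `ℚ`. Completing the square puts the curve
in the form `y² = x³ + (b₂/4) x² + (b₄/2) x + b₆/4`, and the twist of `y² = x³ + a x² + b x + c` is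
`y² = x³ + m a x² + m² b x + m³ c`. -/
def quadraticTwist (W : WeierstrassCurve ℚ) (m : ℚ) : WeierstrassCurve ℚ where
  a₁ := 0
  a₂ := m * (W.b₂ / 4)
  a₃ := 0
  a₄ := m ^ 2 * (W.b₄ / 2)
  a₆ := m ^ 3 * (W.b₆ / 4)

/-- The Mordell-Weil group `E_p(ℚ)`. -/
abbrev PointsQ (p : ℕ) : Type := (curve p).toAffine.Point

/-- The Mordell-Weil group `E_p(ℚ(i))`. -/
abbrev PointsQI (p : ℕ) : Type := ((curve p).baseChange QI).toAffine.Point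

end FiveP

/-! Over `K = ℚ(i)` the curve `y² = x³ + bx`, here with `b = -5p`, has complex multiplication by
`i`, and conjugation anticommutes with it. Hence `(A, B) ↦ A + iB` from two copies of `E(ℚ)` to
`E(K)` has kernel and cokernel killed by 2, so the rank doubles (`GaussianPair.finrank_eq`).

The rank over `ℚ` comes from descent by 2-isogeny. The dual curve `y² = x³ - 4bx` embeds in `E(K)`
by a scaling `u` with `u⁴ = -1/4`; the two isogenies then become multiplication by `1 + i` and `1 -
i`, whose product is 2. Points with nonzero square `x` are divisible by `1 + i`, respectively `1 -
i` (`exists_one_add_i`, `exists_one_sub_i`). Modulo squares `x` is a homomorphism, and its value is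
a divisor `d` of `b` for which `N² = d M⁴ + (b/d) e⁴` is solvable (`exists_quartic`). So there are
finitely many classes, and heights give finite generation.

For `p ≡ 3 mod 4` and `p ≡ ±2 mod 5`, conditions at `p`, `5` and the real place leave only the
classes of the 2-torsion on `E`, and one possible further coset, that of 10, on the dual. It needs
10 to be a square mod `p`, which fails for `p ≡ 7 mod 8`: rank 0. If `p = 8s² - 5`, the dual point
`(10, 40s)` realises it and the rank is at most 1. Lower bounds use explicit points, of infinite
order because they or their doubles are not 2-integral (`not_isOfFinAddOrder`). -/

namespace FiveP

/-! ### Chord-tangent law on `y² = x³ + bx` and scaling maps. -/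

open WeierstrassCurve Affine

variable {F K : Type*} [Field F] [Field K]

/-- `W` is the curve `y² = x³ + b x`, with `b ≠ 0`. -/
structure IsShort (W : WeierstrassCurve F) (b : F) : Prop where
  a₁ : W.a₁ = 0
  a₂ : W.a₂ = 0
  a₃ : W.a₃ = 0
  a₄ : W.a₄ = b
  a₆ : W.a₆ = 0
  ne_zero : b ≠ 0

namespace IsShort

variable {W : WeierstrassCurve F} {b : F}

theorem equation_iff (h : IsShort W b) (x y : F) :
    W.toAffine.Equation x y ↔ y ^ 2 = x ^ 3 + b * x := by
  simp [Affine.equation_iff, h.a₁, h.a₂, h.a₃, h.a₄, h.a₆]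

theorem negY (h : IsShort W b) (x y : F) : W.toAffine.negY x y = -y := by
  simp [Affine.negY, h.a₁, h.a₃]

theorem eq_of_nonsingular (h : IsShort W b) {x y : F} (hxy : W.toAffine.Nonsingular x y) :
    y ^ 2 = x ^ 3 + b * x :=
  (h.equation_iff x y).1 hxy.1

theorem nonsingular [CharZero F] (h : IsShort W b) {x y : F} (hxy : y ^ 2 = x ^ 3 + b * x) :
    W.toAffine.Nonsingular x y := by
  refine (nonsingular_iff' ..).2 ⟨(h.equation_iff x y).2 hxy, ?_⟩
  simp only [h.a₁, h.a₂, h.a₃, h.a₄]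
  by_contra! hc
  have hb := h.ne_zero
  obtain ⟨h1, h2⟩ := hc
  have hy : y = 0 := by simpa using h2
  subst hy
  have hx : x * (x ^ 2 + b) = 0 := by linear_combination -hxy
  rcases mul_eq_zero.1 hx with hx | hx
  · subst hx; simp at h1; exact hb h1
  · apply hb
    have : 2 * b = 0 := by linear_combination h1 + 3 * hx
    simpa using this

theorem isElliptic [CharZero F] (h : IsShort W b) : W.IsElliptic := by
  refine ⟨isUnit_iff_ne_zero.2 ?_⟩
  have : W.Δ = -64 * b ^ 3 := by
    simp only [WeierstrassCurve.Δ, WeierstrassCurve.b₂, WeierstrassCurve.b₄, WeierstrassCurve.b₆,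
      WeierstrassCurve.b₈, h.a₁, h.a₂, h.a₃, h.a₄, h.a₆]
    ring
  rw [this]
  exact mul_ne_zero (by norm_num) (pow_ne_zero _ h.ne_zero)

/-- The point of `y² = x³ + b x` with given coordinates. -/
def point [CharZero F] (h : IsShort W b) (x y : F) (hxy : y ^ 2 = x ^ 3 + b * x) :
    W.toAffine.Point :=
  .some x y (h.nonsingular hxy)

section Add

variable [DecidableEq F] {x₁ y₁ x₂ y₂ : F} {h₁ : W.toAffine.Nonsingular x₁ y₁}
  {h₂ : W.toAffine.Nonsingular x₂ y₂}

omit [DecidableEq F] in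
theorem some_congr {h₁ : W.toAffine.Nonsingular x₁ y₁} {h₂ : W.toAffine.Nonsingular x₂ y₂}
    (hx : x₁ = x₂) (hy : y₁ = y₂) : Point.some x₁ y₁ h₁ = Point.some x₂ y₂ h₂ := by
  subst hx hy; rfl

theorem add_of_neg (h : IsShort W b) (hx : x₁ = x₂) (hy : y₁ = -y₂) :
    Point.some x₁ y₁ h₁ + Point.some x₂ y₂ h₂ = 0 :=
  Point.add_of_Y_eq hx (by rw [h.negY, hy])

/-- Chord and tangent are treated together: the slope is any `l` solving the equation with
denominators cleared, so it can be supplied by hand and checked by a polynomial identity. -/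
theorem add_of_line (h : IsShort W b) {l : F} (hx : ¬(x₁ = x₂ ∧ y₁ = -y₂))
    (hl : x₁ ≠ x₂ → l * (x₁ - x₂) = y₁ - y₂)
    (hl' : x₁ = x₂ → l * (2 * y₁) = 3 * x₁ ^ 2 + b) :
    ∃ h₃, Point.some x₁ y₁ h₁ + Point.some x₂ y₂ h₂ =
      Point.some (l ^ 2 - x₁ - x₂) (-(l * (l ^ 2 - x₁ - x₂ - x₁) + y₁)) h₃ := by
  have hxy : ¬(x₁ = x₂ ∧ y₁ = W.toAffine.negY x₂ y₂) := by rwa [h.negY]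
  have hs : W.toAffine.slope x₁ x₂ y₁ y₂ = l := by
    by_cases hx' : x₁ = x₂
    · have hy : y₁ ≠ W.toAffine.negY x₂ y₂ := fun hh => hxy ⟨hx', hh⟩
      have hyy : y₁ = y₂ := Y_eq_of_Y_ne h₁.1 h₂.1 hx' hy
      rw [slope_of_Y_ne hx' hy]
      rw [h.negY, h.a₁, h.a₂, h.a₄]
      rw [h.negY] at hy
      have h0 : y₁ - -y₁ ≠ 0 := by
        rw [sub_ne_zero]; intro hh; exact hy (by rw [hyy] at hh ⊢; exact hh)
      rw [div_eq_iff h0]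
      linear_combination -hl' hx'
    · rw [slope_of_X_ne hx', div_eq_iff (sub_ne_zero.2 hx'), hl hx']
  have hX : W.toAffine.addX x₁ x₂ l = l ^ 2 - x₁ - x₂ := by
    simp [Affine.addX, h.a₁, h.a₂]
  have hY : W.toAffine.addY x₁ x₂ y₁ l = -(l * (l ^ 2 - x₁ - x₂ - x₁) + y₁) := by
    rw [Affine.addY, Affine.negAddY, h.negY, hX]
  have h3 := nonsingular_add h₁ h₂ hxy
  rw [hs, hX, hY] at h3
  refine ⟨h3, ?_⟩
  rw [Point.add_some hxy]
  exact some_congr (by rw [hs, hX]) (by rw [hs, hY])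

theorem exists_line [CharZero F] (h : IsShort W b) (h₁ : W.toAffine.Nonsingular x₁ y₁)
    (h₂ : W.toAffine.Nonsingular x₂ y₂) (hx : ¬(x₁ = x₂ ∧ y₁ = -y₂)) :
    ∃ l : F, (x₁ ≠ x₂ → l * (x₁ - x₂) = y₁ - y₂) ∧
      (x₁ = x₂ → l * (2 * y₁) = 3 * x₁ ^ 2 + b) := by
  by_cases hx' : x₁ = x₂
  · have hyy : y₁ = y₂ := Y_eq_of_Y_ne h₁.1 h₂.1 hx' (by rw [h.negY]; exact fun hh => hx ⟨hx', hh⟩)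
    have hy0 : y₁ ≠ 0 := by
      rintro rfl; exact hx ⟨hx', by rw [← hyy, neg_zero]⟩
    refine ⟨(3 * x₁ ^ 2 + b) / (2 * y₁), fun hh => (hh hx').elim, fun _ => ?_⟩
    field_simp
  · refine ⟨(y₁ - y₂) / (x₁ - x₂), fun _ => ?_, fun hh => (hx' hh).elim⟩
    rw [div_mul_cancel₀ _ (sub_ne_zero.2 hx')]

end Add

end IsShort

section ScaleHom

variable [CharZero F] [DecidableEq F] [CharZero K] [DecidableEq K]
  {W : WeierstrassCurve F} {b : F} {W' : WeierstrassCurve K} {b' : K}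

/-- The homomorphism `(x, y) ↦ (u² f(x), u³ f(y))` from `y² = x³ + b x` over `F` to
`y² = x³ + u⁴ f(b) x` over `K`. -/
def scaleHom (h : IsShort W b) (h' : IsShort W' b') (f : F →+* K) (u : K) (hu : u ≠ 0)
    (hb : b' = u ^ 4 * f b) : W.toAffine.Point →+ W'.toAffine.Point where
  toFun P := match P with
    | .zero => 0
    | .some x y hxy => h'.point (u ^ 2 * f x) (u ^ 3 * f y) (by
        have := congrArg f (h.eq_of_nonsingular hxy)
        simp only [map_pow, map_add, map_mul] at this
        rw [hb]; linear_combination u ^ 6 * this)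
  map_zero' := rfl
  map_add' := by
    rintro (_ | ⟨x₁, y₁, h₁⟩) (_ | ⟨x₂, y₂, h₂⟩)
    any_goals simp only [← Point.zero_def, zero_add, add_zero]
    by_cases hx : x₁ = x₂ ∧ y₁ = -y₂
    · rw [h.add_of_neg hx.1 hx.2]
      exact (h'.add_of_neg (by rw [hx.1]) (by rw [hx.2, map_neg]; ring)).symm
    · obtain ⟨l, hl, hl'⟩ := h.exists_line h₁ h₂ hx
      obtain ⟨h₃, e⟩ := h.add_of_line (h₁ := h₁) (h₂ := h₂) hx hl hl'
      rw [e]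
      -- Coincidences among coordinates are preserved and reflected, so both sides fall in the same
      -- case of the addition law; the slope scales by `u`.
      have inj : ∀ n : ℕ, ∀ s t : F, u ^ n * f s = u ^ n * f t ↔ s = t := fun n s t => by
        rw [mul_right_inj' (pow_ne_zero _ hu), f.injective.eq_iff]
      have hx' : ¬(u ^ 2 * f x₁ = u ^ 2 * f x₂ ∧ u ^ 3 * f y₁ = -(u ^ 3 * f y₂)) := by
        rw [← mul_neg, ← map_neg, inj, inj]; exact hx
      obtain ⟨h₄, e'⟩ := h'.add_of_line (h₁ := (h'.nonsingular (by
          have := congrArg f (h.eq_of_nonsingular h₁)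
          simp only [map_pow, map_add, map_mul] at this
          rw [hb]; linear_combination u ^ 6 * this)))
        (h₂ := (h'.nonsingular (by
          have := congrArg f (h.eq_of_nonsingular h₂)
          simp only [map_pow, map_add, map_mul] at this
          rw [hb]; linear_combination u ^ 6 * this)))
        (l := u * f l) hx'
        (fun hne => by
          have := congrArg f (hl fun hh => hne (by rw [hh]))
          simp only [map_mul, map_sub] at this
          linear_combination u ^ 3 * this)
        (fun he => by
          have := congrArg f (hl' ((inj 2 _ _).1 he))
          simp only [map_mul, map_add, map_pow, map_ofNat] at this
          rw [hb]; linear_combination u ^ 4 * this)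
      refine Eq.trans ?_ e'.symm
      refine IsShort.some_congr ?_ ?_
      · simp only [map_sub, map_pow]; ring
      · simp only [map_neg, map_add, map_mul, map_sub, map_pow]; ring

variable {h : IsShort W b} {h' : IsShort W' b'} {f : F →+* K} {u : K} {hu : u ≠ 0}
  {hb : b' = u ^ 4 * f b}

theorem scaleHom_some {x y : F} (hxy : W.toAffine.Nonsingular x y) :
    ∃ h₁, scaleHom h h' f u hu hb (.some x y hxy) = .some (u ^ 2 * f x) (u ^ 3 * f y) h₁ :=
  ⟨_, rfl⟩

theorem scaleHom_injective : Function.Injective (scaleHom h h' f u hu hb) := by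
  rw [injective_iff_map_eq_zero]
  rintro (_ | ⟨x, y, hxy⟩) hP
  · rfl
  · exact (Point.some_ne_zero _ hP).elim

end ScaleHom

end FiveP

/-! ### Square classes of `x` and division by `1 + i` and `1 - i`. -/

namespace FiveP

open WeierstrassCurve Affine

variable {F K : Type*} [Field F] [Field K]

namespace IsShort

variable {W : WeierstrassCurve F} {b : F} [CharZero F] [DecidableEq F]

/-- The rational point `(0, 0)` of order two. -/
def origin (h : IsShort W b) : W.toAffine.Point :=
  h.point 0 0 (by ring)

theorem origin_add_origin (h : IsShort W b) : h.origin + h.origin = 0 :=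
  h.add_of_neg rfl neg_zero.symm

omit [DecidableEq F] in
theorem some_zero_eq_origin (h : IsShort W b) {x y : F} (hxy : W.toAffine.Nonsingular x y)
    (hx : x = 0) : Point.some x y hxy = h.origin := by
  have := h.eq_of_nonsingular hxy
  subst hx
  exact some_congr rfl (by simpa using this)

omit [CharZero F] [DecidableEq F] in
theorem neg_some (h : IsShort W b) {x y : F} (hxy : W.toAffine.Nonsingular x y) :
    ∃ h', -Point.some x y hxy = Point.some x (-y) h' :=
  ⟨h.negY x y ▸ (nonsingular_neg ..).2 hxy, by
    rw [Point.neg_some]; exact some_congr rfl (h.negY x y)⟩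

/-- A point is *square-like* if it is the point at infinity or its `x`-coordinate is a square. -/
def SquareLike (P : W.toAffine.Point) : Prop :=
  P = 0 ∨ ∃ w y h, P = Point.some (w ^ 2) y h

/-- The `x`-coordinate is a homomorphism modulo squares. -/
theorem squareLike_sub (h : IsShort W b) {x₁ y₁ x₂ y₂ z : F} (h₁ : W.toAffine.Nonsingular x₁ y₁)
    (h₂ : W.toAffine.Nonsingular x₂ y₂) (hz : z ≠ 0) (hx : x₁ * x₂ = z ^ 2) :
    SquareLike (Point.some x₁ y₁ h₁ - Point.some x₂ y₂ h₂) := by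
  obtain ⟨h₂', e⟩ := h.neg_some h₂
  rw [sub_eq_add_neg, e]
  by_cases hn : x₁ = x₂ ∧ y₁ = - -y₂
  · left; exact h.add_of_neg hn.1 hn.2
  · right
    obtain ⟨l, hl, hl'⟩ := h.exists_line h₁ h₂' hn
    obtain ⟨h₃, e'⟩ := h.add_of_line (h₁ := h₁) (h₂ := h₂') hn hl hl'
    have E₁ := h.eq_of_nonsingular h₁
    have E₂ := h.eq_of_nonsingular h₂
    -- The line `y = lx + ν` meets the cubic in three points whose `x`-coordinates have product
    -- `ν²`.
    have key : l ^ 2 - x₁ - x₂ = ((y₁ - l * x₁) / z) ^ 2 := by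
      rw [div_pow, eq_div_iff (pow_ne_zero _ hz), ← hx]
      by_cases hx' : x₁ = x₂
      · have hl2 := hl' hx'
        subst hx'
        have h0 : y₁ ≠ 0 := by
          rintro rfl
          have : y₂ ^ 2 = 0 := by rw [E₂, ← E₁]; ring
          exact hn ⟨rfl, by simp at this; rw [this]; simp⟩
        linear_combination x₁ * hl2 - E₁
      · have hl2 := hl hx'
        have h0 : x₁ - x₂ ≠ 0 := sub_ne_zero.2 hx'
        apply mul_left_cancel₀ h0
        have hy : y₂ = l * (x₁ - x₂) - y₁ := by linear_combination -hl2
        subst hy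
        linear_combination x₂ * E₁ - x₁ * E₂
    rw [e']
    rw [key] at h₃
    exact ⟨_, _, h₃, some_congr key (by rw [key])⟩

/-- On a line through `(0, 0)` the other two `x`-coordinates have product `b`. Translation by this
point thus multiplies the square class by `b`. -/
theorem add_origin (h : IsShort W b) {x y : F} (hxy : W.toAffine.Nonsingular x y) (hx : x ≠ 0) :
    ∃ h', Point.some x y hxy + h.origin = Point.some (b / x) (-(b * y / x ^ 2)) h' := by
  have E := h.eq_of_nonsingular hxy
  obtain ⟨h₃, e⟩ := h.add_of_line (h₁ := hxy) (h₂ := h.nonsingular (x := 0) (y := 0) (by ring))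
    (l := y / x) (fun hh => hx hh.1) (fun _ => by field_simp; ring) (fun hh => (hx hh).elim)
  have key : (y / x) ^ 2 - x - 0 = b / x := by
    field_simp
    linear_combination E
  have key' : -(y / x * ((y / x) ^ 2 - x - 0 - x) + y) = -(b * y / x ^ 2) := by
    rw [key]
    field_simp
    ring
  have h₄ := h₃
  rw [key', key] at h₄
  exact ⟨h₄, e.trans (some_congr key key')⟩

/-- The tangent construction with `(3x² + b)² - 8xy² = (x² - b)²`. -/
theorem double (h : IsShort W b) {x y : F} (hxy : W.toAffine.Nonsingular x y) (hy : y ≠ 0) :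
    ∃ Y h', Point.some x y hxy + Point.some x y hxy =
      Point.some (((x ^ 2 - b) / (2 * y)) ^ 2) Y h' := by
  have E := h.eq_of_nonsingular hxy
  obtain ⟨h₃, e⟩ := h.add_of_line (h₁ := hxy) (h₂ := hxy)
    (l := (3 * x ^ 2 + b) / (2 * y)) (fun hh => hy (self_eq_neg.1 hh.2)) (fun hh => (hh rfl).elim)
    (fun _ => by field_simp)
  have key : ((3 * x ^ 2 + b) / (2 * y)) ^ 2 - x - x = ((x ^ 2 - b) / (2 * y)) ^ 2 := by
    field_simp
    linear_combination (-8 * x) * E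
  rw [key] at h₃
  exact ⟨_, h₃, e.trans (some_congr key (by rw [key]))⟩

theorem y_eq_zero_of_add_self_eq_zero (h : IsShort W b) {x y : F} (hxy : W.toAffine.Nonsingular x y)
    (h2 : Point.some x y hxy + Point.some x y hxy = 0) : y = 0 := by
  by_contra hy
  obtain ⟨Y, h', e⟩ := h.double hxy hy
  exact Point.some_ne_zero _ (e.symm.trans h2)

end IsShort

/-- The curves `W : y² = x³ + b x` and `W' : y² = x³ - 4 b x` over a field `F`, and the curve
`V : y² = x³ + b x` over a field `K` which contains `F` and a square root of `-1`. -/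
structure GaussianPair (F K : Type*) [Field F] [Field K] where
  f : F →+* K
  i : K
  i_sq : i ^ 2 = -1
  b : F
  W : WeierstrassCurve F
  W' : WeierstrassCurve F
  V : WeierstrassCurve K
  hW : IsShort W b
  hW' : IsShort W' (-4 * b)
  hV : IsShort V (f b)

namespace GaussianPair

variable (D : GaussianPair F K)

theorem i_ne_zero : D.i ≠ 0 := by
  intro h; have := D.i_sq; simp [h] at this

variable [CharZero F] [DecidableEq F] [CharZero K] [DecidableEq K]

omit [CharZero F] [DecidableEq F] [DecidableEq K] in
theorem one_add_i_div_two_ne_zero : (1 + D.i) / 2 ≠ 0 := by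
  intro h
  have h1 : D.i = -1 := by linear_combination 2 * h
  have := D.i_sq
  rw [h1] at this
  norm_num at this

/-- The inclusion of `W(F)` into `V(K)`. -/
def incl : D.W.toAffine.Point →+ D.V.toAffine.Point :=
  scaleHom D.hW D.hV D.f 1 one_ne_zero (by ring)

/-- The embedding of `W'(F)` into `V(K)`. -/
def incl' : D.W'.toAffine.Point →+ D.V.toAffine.Point :=
  -- `((1 + i)/2)⁴ = -1/4` cancels the coefficient `-4` of the dual curve.
  scaleHom D.hW' D.hV D.f ((1 + D.i) / 2) D.one_add_i_div_two_ne_zero (by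
    simp only [map_mul, map_neg, map_ofNat]
    linear_combination D.f D.b * (1 / 4) * (D.i ^ 2 + 4 * D.i + 5 ) * D.i_sq)

/-- The complex multiplication `(x, y) ↦ (-x, i y)`. -/
def mulI : D.V.toAffine.Point →+ D.V.toAffine.Point :=
  scaleHom D.hV D.hV (RingHom.id K) (-D.i) (neg_ne_zero.2 D.i_ne_zero) (by
    simp only [RingHom.id_apply]
    linear_combination (-D.f D.b) * (D.i ^ 2 - 1) * D.i_sq)

theorem incl_injective : Function.Injective D.incl := scaleHom_injective

theorem incl_some {x y : F} (h) :
    ∃ h', D.incl (.some x y h) = .some (D.f x) (D.f y) h' := by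
  obtain ⟨h₁, e⟩ := scaleHom_some (h := D.hW) (h' := D.hV) (f := D.f) (u := 1)
    (hu := one_ne_zero) (hb := by ring) h
  simp only [one_pow, one_mul] at h₁
  exact ⟨h₁, e.trans (IsShort.some_congr (by ring) (by ring))⟩

theorem incl'_some {x y : F} (h) :
    ∃ h', D.incl' (.some x y h) = .some (D.i / 2 * D.f x) ((D.i - 1) / 4 * D.f y) h' := by
  have e2 : ((1 + D.i) / 2) ^ 2 = D.i / 2 := by linear_combination (1 / 4) * D.i_sq
  have e3 : ((1 + D.i) / 2) ^ 3 = (D.i - 1) / 4 := by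
    linear_combination (1 / 8) * (D.i + 3) * D.i_sq
  rw [← e2, ← e3]
  exact ⟨_, rfl⟩

omit [CharZero F] [DecidableEq F] in
theorem mulI_some {x y : K} (h) :
    ∃ h', D.mulI (.some x y h) = .some (-x) (D.i * y) h' := by
  have e2 : (-D.i) ^ 2 = -1 := by rw [neg_sq, D.i_sq]
  have e3 : (-D.i) ^ 3 = D.i := by linear_combination (-D.i) * D.i_sq
  have : ∃ h', D.mulI (.some x y h) = .some ((-D.i) ^ 2 * x) ((-D.i) ^ 3 * y) h' := ⟨_, rfl⟩
  simpa only [e2, e3, neg_one_mul] using this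

omit [CharZero F] [DecidableEq F] in
theorem mulI_mulI (P) : D.mulI (D.mulI P) = -P := by
  rcases P with _ | ⟨x, y, h⟩
  · rfl
  · obtain ⟨h₁, e₁⟩ := D.mulI_some h
    obtain ⟨h₂, e₂⟩ := D.mulI_some h₁
    obtain ⟨h₃, e₃⟩ := D.hV.neg_some h
    rw [e₁, e₂, e₃]
    exact IsShort.some_congr (by ring) (by linear_combination y * D.i_sq)

/-- The point `(0, 0)` is 2-torsion and fixed by `i`, so `1 + i` kills it. -/
theorem mulI_add_of_origin (P) (hP : P = 0 ∨ P = D.hW'.origin) :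
    D.incl' P + D.mulI (D.incl' P) = 0 := by
  rcases hP with rfl | rfl
  · simp
  · obtain ⟨h₁, e₁⟩ := D.incl'_some (D.hW'.nonsingular (x := 0) (y := 0) (by ring))
    obtain ⟨h₂, e₂⟩ := D.mulI_some h₁
    rw [show D.incl' D.hW'.origin = _ from e₁, e₂]
    exact D.hV.add_of_neg (by simp) (by simp)

/-- Points of `W` whose `x`-coordinate is a nonzero square are divisible by `1 + i`. -/
theorem exists_one_add_i {w y : F} (h) (hw : w ≠ 0) :
    ∃ Q, D.incl (.some (w ^ 2) y h) = D.incl' Q + D.mulI (D.incl' Q) := by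
  have E := D.hW.eq_of_nonsingular h
  obtain ⟨s, rfl⟩ : ∃ s, y = w * s := ⟨y / w, by field_simp⟩
  have hs : D.b = s ^ 2 - w ^ 4 := by
    apply mul_left_cancel₀ (pow_ne_zero 2 hw)
    linear_combination -E
  -- The image of `Q` and its multiple by `i` have opposite `x`, so their sum has `x` equal to the
  -- squared slope; this `Q` makes the slope `w`.
  have hQ := D.hW'.nonsingular (x := 2 * (w ^ 2 + s)) (y := 4 * w * (w ^ 2 + s)) (by
    rw [hs]; ring)
  refine ⟨.some _ _ hQ, ?_⟩
  have h0 : w ^ 2 + s ≠ 0 := by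
    intro h0
    apply D.hW.ne_zero
    rw [hs]; linear_combination (s - w ^ 2) * h0
  obtain ⟨h₁, e₁⟩ := D.incl_some h
  obtain ⟨h₂, e₂⟩ := D.incl'_some hQ
  obtain ⟨h₃, e₃⟩ := D.mulI_some h₂
  rw [e₁, e₂, e₃]
  have hx0 : D.i * D.f (w ^ 2 + s) ≠ 0 := mul_ne_zero D.i_ne_zero ((map_ne_zero D.f).2 h0)
  have hne : D.i / 2 * D.f (2 * (w ^ 2 + s)) ≠ -(D.i / 2 * D.f (2 * (w ^ 2 + s))) := by
    intro hh
    rw [self_eq_neg] at hh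
    apply hx0
    rw [map_mul, map_ofNat] at hh
    linear_combination hh
  obtain ⟨h₄, e₄⟩ := D.hV.add_of_line (h₁ := h₂) (h₂ := h₃) (l := D.f w) (fun hh => hne hh.1)
    (fun _ => by
      simp only [map_mul, map_add, map_pow, map_ofNat]
      linear_combination D.f w * (D.f w ^ 2 + D.f s) * D.i_sq)
    (fun hh => (hne hh).elim)
  rw [e₄]
  refine IsShort.some_congr ?_ ?_
  · simp only [map_pow]; ring
  · simp only [map_mul, map_add, map_pow, map_ofNat]; ring

/-- Points of `W'` whose `x`-coordinate is a nonzero square are divisible by `1 - i`. -/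
theorem exists_one_sub_i {w y : F} (h) (hw : w ≠ 0) :
    ∃ R, D.incl' (.some (w ^ 2) y h) = D.incl R - D.mulI (D.incl R) := by
  have E := D.hW'.eq_of_nonsingular h
  obtain ⟨s, rfl⟩ : ∃ s, y = w * s := ⟨y / w, by field_simp⟩
  have hs : D.b = (w ^ 4 - s ^ 2) / 4 := by
    rw [eq_div_iff (by norm_num)]
    apply mul_left_cancel₀ (pow_ne_zero 2 hw)
    linear_combination E
  -- Chosen so that the line through `R` and `-iR` has slope `w(1 + i)/2`, with square `iw²/2`.
  have hR := D.hW.nonsingular (x := (w ^ 2 + s) / 2) (y := w * ((w ^ 2 + s) / 2)) (by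
    rw [hs]; ring)
  refine ⟨.some _ _ hR, ?_⟩
  have h0 : w ^ 2 + s ≠ 0 := by
    intro h0
    apply D.hW.ne_zero
    rw [hs]; linear_combination (w ^ 2 - s) / 4 * h0
  obtain ⟨h₁, e₁⟩ := D.incl'_some h
  obtain ⟨h₂, e₂⟩ := D.incl_some hR
  obtain ⟨h₃, e₃⟩ := D.mulI_some h₂
  obtain ⟨h₃', e₃'⟩ := D.hV.neg_some h₃
  rw [e₁, e₂, e₃, sub_eq_add_neg (Point.some ..), e₃']
  have hne : D.f ((w ^ 2 + s) / 2) ≠ -(D.f ((w ^ 2 + s) / 2)) := by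
    intro hh
    rw [self_eq_neg, map_eq_zero, div_eq_zero_iff] at hh
    exact hh.elim h0 two_ne_zero
  obtain ⟨h₄, e₄⟩ := D.hV.add_of_line (h₁ := h₂) (h₂ := h₃') (l := D.f w * (1 + D.i) / 2)
    (fun hh => hne hh.1)
    (fun _ => by
      simp only [map_mul, map_add, map_pow, map_ofNat, map_div₀]
      ring)
    (fun hh => (hne hh).elim)
  rw [e₄]
  have key : (D.f w * (1 + D.i) / 2) ^ 2 - D.f ((w ^ 2 + s) / 2) - -D.f ((w ^ 2 + s) / 2) =
      D.i / 2 * D.f w ^ 2 := by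
    linear_combination (D.f w ^ 2 / 4) * D.i_sq
  refine IsShort.some_congr ?_ ?_
  · rw [key, map_pow]
  · rw [key]
    simp only [map_mul, map_add, map_pow, map_ofNat, map_div₀]
    linear_combination (D.f w ^ 3 / 4) * D.i_sq

end GaussianPair

end FiveP

/-! ### Heights and finite generation. -/

namespace FiveP

open WeierstrassCurve Affine Height

variable {F : Type*} [Field F]

namespace IsShort

variable {W : WeierstrassCurve F} {b : F}

/-- Here `(s : t : u)` stands for `(x₁x₂ : x₁ + x₂ : 1)`, and the output is the same triple for `P +
Q` and `P - Q`. -/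
theorem eval_addSubMap (h : IsShort W b) (s t u : F) :
    (fun i => (addSubMap W i).eval ![s, t, u]) =
      ![(s - b * u) ^ 2, 2 * t * (s + b * u), t ^ 2 - 4 * s * u] := by
  have h₂ : W.b₂ = 0 := by simp [WeierstrassCurve.b₂, h.a₁, h.a₂]
  have h₄ : W.b₄ = 2 * b := by simp [WeierstrassCurve.b₄, h.a₁, h.a₃, h.a₄]
  have h₆ : W.b₆ = 0 := by simp [WeierstrassCurve.b₆, h.a₃, h.a₆]
  have h₈ : W.b₈ = -b ^ 2 := by
    simp [WeierstrassCurve.b₈, h.a₁, h.a₂, h.a₃, h.a₄, h.a₆]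
  funext i
  fin_cases i
  · simp [addSubMap, h₄, h₆, h₈]; ring
  · simp [addSubMap, h₂, h₄, h₆]; ring
  · simp [addSubMap]

variable [CharZero F] [DecidableEq F]

/-- The relation between `x(P), x(Q)` and `x(P + Q), x(P - Q)`. -/
theorem exists_addSubMap_eq_smul (h : IsShort W b) (P Q : W.toAffine.Point) :
    ∃ c : F, c ≠ 0 ∧ (fun i => (addSubMap W i).eval (P.sym2x Q)) =
      c • (P + Q).sym2x (P - Q) := by
  -- The diagonal `P = Q` needs the doubling formula; `P = -Q` reduces to it by symmetry.
  have self : ∀ P : W.toAffine.Point, ∃ c : F, c ≠ 0 ∧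
      (fun i => (addSubMap W i).eval (P.sym2x P)) = c • (P + P).sym2x 0 := by
    rintro (_ | ⟨x, y, hP⟩)
    · refine ⟨1, one_ne_zero, ?_⟩
      rw [← Point.zero_def, add_zero, Point.sym2x_zero_zero, h.eval_addSubMap]
      simp
    · rw [Point.sym2x_some_some, h.eval_addSubMap]
      have E := h.eq_of_nonsingular hP
      by_cases hy : y = 0
      · subst hy
        have hx : x * (x ^ 2 + b) = 0 := by linear_combination -E
        refine ⟨(x ^ 2 - b) ^ 2, ?_, ?_⟩
        · refine pow_ne_zero _ fun h0 => h.ne_zero ?_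
          rcases mul_eq_zero.1 hx with hx | hx
          · subst hx; linear_combination -h0
          · have : 2 * b = 0 := by linear_combination hx - h0
            simpa using this
        · rw [h.add_of_neg rfl neg_zero.symm, Point.sym2x_zero_zero]
          ext i; fin_cases i
          · simp; ring
          · change 2 * (x + x) * (x * x + b * 1) = (x ^ 2 - b) ^ 2 * 0
            linear_combination 4 * hx
          · simp; ring
      · obtain ⟨Y, h', e⟩ := h.double hP hy
        refine ⟨4 * y ^ 2, by simpa using hy, ?_⟩
        rw [e, Point.sym2x_some_zero]
        ext i; fin_cases i
        · simp; field_simp; ring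
        · simp; linear_combination (-4) * E
        · simp; ring
  have key : ∀ P Q : W.toAffine.Point, P.xRep = Q.xRep → ∃ c : F, c ≠ 0 ∧
      (fun i => (addSubMap W i).eval (P.sym2x Q)) = c • (P + Q).sym2x (P - Q) := by
    intro P Q hPQ
    rcases Point.eq_or_eq_neg_of_xRep_eq_xRep hPQ with rfl | rfl
    · simpa using self P
    · obtain ⟨c, hc, e⟩ := self Q
      refine ⟨c, hc, ?_⟩
      rw [Point.sym2x_neg_left, e, neg_add_cancel, Point.sym2x_comm,
        ← neg_add', Point.sym2x_neg_right]
  by_cases hPQ : P.xRep = Q.xRep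
  · exact key P Q hPQ
  rcases P with _ | ⟨x₁, y₁, h₁⟩ <;> rcases Q with _ | ⟨x₂, y₂, h₂⟩
  · exact (hPQ rfl).elim
  · refine ⟨1, one_ne_zero, ?_⟩
    rw [← Point.zero_def, zero_add, zero_sub, Point.sym2x_neg_right, Point.sym2x_some_some,
      Point.sym2x_zero_some, h.eval_addSubMap]
    ext i; fin_cases i <;> simp <;> ring
  · refine ⟨1, one_ne_zero, ?_⟩
    rw [← Point.zero_def, add_zero, sub_zero, Point.sym2x_some_some,
      Point.sym2x_some_zero, h.eval_addSubMap]
    ext i; fin_cases i <;> simp <;> ring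
  · have hx : x₁ ≠ x₂ := by
      intro hh; apply hPQ; simp [hh]
    have hd := sub_ne_zero.2 hx
    obtain ⟨h₂', e₂⟩ := h.neg_some h₂
    obtain ⟨h₃, e₃⟩ := h.add_of_line (h₁ := h₁) (h₂ := h₂) (l := (y₁ - y₂) / (x₁ - x₂))
      (fun hh => hx hh.1) (fun _ => by field_simp) (fun hh => (hx hh).elim)
    obtain ⟨h₄, e₄⟩ := h.add_of_line (h₁ := h₁) (h₂ := h₂') (l := (y₁ + y₂) / (x₁ - x₂))
      (fun hh => hx hh.1) (fun _ => by field_simp; ring) (fun hh => (hx hh).elim)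
    have E₁ := h.eq_of_nonsingular h₁
    have E₂ := h.eq_of_nonsingular h₂
    refine ⟨(x₁ - x₂) ^ 2, pow_ne_zero _ hd, ?_⟩
    rw [e₃, sub_eq_add_neg (Point.some ..), e₂, e₄, Point.sym2x_some_some,
      Point.sym2x_some_some, h.eval_addSubMap]
    ext i; fin_cases i
    · simp
      field_simp
      have e1 : (y₁ - y₂) ^ 2 = x₁ ^ 3 + b * x₁ + x₂ ^ 3 + b * x₂ - 2 * (y₁ * y₂) := by
        linear_combination E₁ + E₂
      have e2 : (y₁ + y₂) ^ 2 = x₁ ^ 3 + b * x₁ + x₂ ^ 3 + b * x₂ + 2 * (y₁ * y₂) := by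
        linear_combination E₁ + E₂
      have e3 : (y₁ * y₂) ^ 2 = (x₁ ^ 3 + b * x₁) * (x₂ ^ 3 + b * x₂) := by
        rw [mul_pow, E₁, E₂]
      rw [e1, e2]
      linear_combination 4 * e3
    · simp
      field_simp
      linear_combination (-2) * E₁ - 2 * E₂
    · simp; ring

/-- The naïve height is almost a quadratic form. -/
theorem exists_parallelogram_bound [AdmissibleAbsValues F] (h : IsShort W b) :
    ∃ C, ∀ P Q : W.toAffine.Point,
      |logHeight (P + Q).xRep + logHeight (P - Q).xRep -
        2 * (logHeight P.xRep + logHeight Q.xRep)| ≤ C := by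
  have := h.isElliptic
  obtain ⟨C₁, hC₁⟩ := abs_logHeight_addSubMap_sub_two_mul_logHeight_le W
  obtain ⟨C₂, hC₂⟩ := abs_logHeight_sym2_sub_le F
  have vec : ∀ P : W.toAffine.Point, ![P.xRep 0, P.xRep 1] = P.xRep := by
    intro P; ext i; fin_cases i <;> rfl
  have sym : ∀ P Q : W.toAffine.Point,
      |logHeight (P.sym2x Q) - (logHeight P.xRep + logHeight Q.xRep)| ≤ C₂ := by
    intro P Q
    have := @hC₂ (P.xRep 0) (P.xRep 1) (Q.xRep 0) (Q.xRep 1)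
      (by rw [vec]; exact P.xRep_ne_zero) (by rw [vec]; exact Q.xRep_ne_zero)
    rwa [vec, vec] at this
  -- `C₂` enters twice for `(P, Q)`, whose height is doubled, and once for `(P + Q, P - Q)`.
  refine ⟨C₁ + 3 * C₂, fun P Q => ?_⟩
  have s₁ := sym P Q
  have s₂ := sym (P + Q) (P - Q)
  have s₃ := hC₁ (P.sym2x Q)
  obtain ⟨c, hc, e⟩ := h.exists_addSubMap_eq_smul P Q
  rw [e, logHeight_smul_eq_logHeight _ hc] at s₃
  rw [abs_le] at *
  constructor <;> linarith [s₁.1, s₁.2, s₂.1, s₂.2, s₃.1, s₃.2]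

omit [CharZero F] [DecidableEq F] in
theorem northcott_logHeight [AdmissibleAbsValues F] [Northcott (logHeight₁ (K := F))] :
    Northcott fun P : W.toAffine.Point => logHeight P.xRep := by
  refine ⟨fun B => Set.Finite.of_finite_fibers Point.xRep ?_ ?_⟩
  · refine Set.Finite.subset (((Northcott.finite_le (h := logHeight₁ (K := F)) B).image
      fun x => ![x, 1]).insert ![1, 0]) ?_
    rintro _ ⟨P, hP, rfl⟩
    rcases P with _ | ⟨x, y, hxy⟩
    · left; rfl
    · right
      refine ⟨x, ?_, rfl⟩
      simpa [logHeight₁_eq_logHeight] using hP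
  · rintro _ ⟨P, -, rfl⟩
    refine Set.Finite.subset (Set.toFinite {P, -P}) ?_
    rintro Q ⟨-, hQ⟩
    exact Point.eq_or_eq_neg_of_xRep_eq_xRep hQ

/-- A descent criterion for finite generation. -/
theorem finite_of_descent [AdmissibleAbsValues F] [Northcott (logHeight₁ (K := F))]
    (h : IsShort W b) {S : Set W.toAffine.Point} (hS : S.Finite)
    (H : ∀ P, ∃ s ∈ S, ∃ R, P = s + (R + R)) : Module.Finite ℤ W.toAffine.Point := by
  obtain ⟨C, hC⟩ := h.exists_parallelogram_bound
  have := northcott_logHeight (W := W)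
  rw [Module.Finite.iff_addGroup_fg]
  refine AddCommGroup.fg_of_descent' (h := fun P : W.toAffine.Point => logHeight P.xRep) (C := C)
    ?_ (fun P => logHeight_nonneg _) hC
  have := hS.to_subtype
  have : Finite (W.toAffine.Point ⧸ (nsmulAddMonoidHom (α := W.toAffine.Point) 2).range) := by
    refine Finite.of_surjective (fun s : S => QuotientAddGroup.mk s.1) fun q => ?_
    induction q using QuotientAddGroup.induction_on with
    | H P =>
      obtain ⟨s, hs, R, rfl⟩ := H P
      refine ⟨⟨s, hs⟩, ?_⟩
      rw [QuotientAddGroup.eq]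
      exact ⟨R, by simp [two_nsmul]⟩
  exact AddSubgroup.finiteIndex_of_finite_quotient

end IsShort

end FiveP

/-! ### Quartics attached to rational points, and weak Mordell–Weil. -/

namespace FiveP

open WeierstrassCurve Affine

/-- An integer `d` dividing `b`, coprime integers `M`, `e` and an integer `N` with
`x = d (M / e)²` and `N² = d M⁴ + (b / d) e⁴`. -/
theorem exists_quartic {b : ℤ} {x y : ℚ} (hx : x ≠ 0) (h : y ^ 2 = x ^ 3 + b * x) :
    ∃ d c M e N : ℤ, Squarefree d ∧ d * c = b ∧ IsCoprime M e ∧ M ≠ 0 ∧ e ≠ 0 ∧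
      x = d * ((M : ℚ) / e) ^ 2 ∧ N ^ 2 = d * M ^ 4 + c * e ^ 4 := by
  obtain ⟨d, z, hd, hz, hxz⟩ : ∃ (d : ℤ) (z : ℚ), Squarefree d ∧ z ≠ 0 ∧ x = d * z ^ 2 := by
    obtain ⟨A, B, hAB, hA⟩ := Nat.sq_mul_squarefree (x.num * x.den).natAbs
    have hden : (x.den : ℚ) ≠ 0 := by exact_mod_cast x.den_ne_zero
    have hnum : x.num ≠ 0 := Rat.num_ne_zero.2 hx
    have hq : x = (x.num * x.den : ℤ) / (x.den : ℚ) ^ 2 := by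
      conv_lhs => rw [← Rat.num_div_den x]
      push_cast
      field_simp
    have hB : (B : ℚ) ≠ 0 := by
      rintro hB
      have hB : B = 0 := by exact_mod_cast hB
      have h0 : (x.num * x.den).natAbs = 0 := by rw [← hAB, hB]; ring
      exact mul_ne_zero hnum (by exact_mod_cast x.den_ne_zero) (Int.natAbs_eq_zero.1 h0)
    rcases Int.natAbs_eq (x.num * x.den) with hs | hs
    · refine ⟨A, B / x.den, Int.squarefree_natCast.2 hA, div_ne_zero hB hden, ?_⟩
      refine hq.trans ?_
      rw [hs, ← hAB]; push_cast; ring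
    · refine ⟨-A, B / x.den, Int.squarefree_natAbs.1 (by simpa using hA), div_ne_zero hB hden, ?_⟩
      refine hq.trans ?_
      rw [hs, ← hAB]; push_cast; ring
  have hd0 : d ≠ 0 := hd.ne_zero
  have hden : (z.den : ℚ) ≠ 0 := by exact_mod_cast z.den_ne_zero
  have hM : z.num ≠ 0 := Rat.num_ne_zero.2 hz
  have hcop : IsCoprime z.num (z.den : ℤ) := Rat.isCoprime_num_den z
  have hzz : z = z.num / z.den := (Rat.num_div_den z).symm
  -- A rational whose square is an integer is an integer; `d` being squarefree, it is then divisible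
  -- by `d`, and the quotient is `N`.
  have hU : (y * (z.den : ℚ) ^ 2 / z) ^ 2 = ((d * (d ^ 2 * z.num ^ 4 + b * z.den ^ 4) : ℤ) : ℚ) := by
    push_cast
    have h4 : (z.num : ℚ) = z * z.den := by rw [Rat.mul_den_eq_num]
    rw [div_pow, mul_pow, h, hxz, div_eq_iff (pow_ne_zero 2 hz), h4]
    ring
  obtain ⟨U, hU'⟩ : ∃ U : ℤ, (U : ℚ) = y * (z.den : ℚ) ^ 2 / z := by
    have hi : _root_.IsIntegral ℤ (y * (z.den : ℚ) ^ 2 / z) := by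
      refine _root_.IsIntegral.of_pow (n := 2) (by norm_num) ?_
      rw [hU]
      exact isIntegral_algebraMap (R := ℤ) (A := ℚ)
    obtain ⟨U, hU⟩ := IsIntegrallyClosed.isIntegral_iff.1 hi
    exact ⟨U, by rw [← hU, eq_intCast]⟩
  rw [← hU'] at hU
  have hUZ : U ^ 2 = d * (d ^ 2 * z.num ^ 4 + b * (z.den : ℤ) ^ 4) := by exact_mod_cast hU
  obtain ⟨N, rfl⟩ : d ∣ U := (hd.dvd_pow_iff_dvd two_ne_zero).1 ⟨_, hUZ⟩
  have hN : d * N ^ 2 = d ^ 2 * z.num ^ 4 + b * (z.den : ℤ) ^ 4 := by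
    apply mul_left_cancel₀ hd0
    linear_combination hUZ
  -- A common prime of `d` and the denominator would divide `N`, then the numerator, since it
  -- divides `d` only once. Coprimality then forces `d ∣ b`.
  have hde : IsCoprime d (z.den : ℤ) := by
    refine isCoprime_of_prime_dvd (fun hh => hd0 hh.1) ?_
    rintro q hq ⟨d', rfl⟩ ⟨e', he'⟩
    have hqd' : ¬q ∣ d' := fun hh => by
      obtain ⟨k, rfl⟩ := hh
      exact hq.not_isUnit (hd q ⟨k, by ring⟩)
    rw [he'] at hN
    have h1 : q ∣ d' * N ^ 2 := by
      refine (mul_dvd_mul_iff_left hq.ne_zero).1 ⟨d' ^ 2 * z.num ^ 4 + b * q ^ 2 * e' ^ 4, ?_⟩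
      linear_combination hN
    obtain ⟨n, rfl⟩ := hq.dvd_of_dvd_pow ((hq.dvd_or_dvd h1).resolve_left hqd')
    have h2 : q ∣ d' ^ 2 * z.num ^ 4 := by
      refine (mul_dvd_mul_iff_left (pow_ne_zero 2 hq.ne_zero)).1
        ⟨d' * n ^ 2 - b * q * e' ^ 4, ?_⟩
      linear_combination -hN
    have h3 : q ∣ z.num := hq.dvd_of_dvd_pow
      ((hq.dvd_or_dvd h2).resolve_left fun hh => hqd' (hq.dvd_of_dvd_pow hh))
    exact hq.not_isUnit (hcop.isUnit_of_dvd' h3 ⟨e', he'⟩)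
  obtain ⟨c, rfl⟩ : d ∣ b := by
    refine (hde.pow_right (n := 4)).dvd_of_dvd_mul_right ⟨N ^ 2 - d * z.num ^ 4, ?_⟩
    linear_combination -hN
  refine ⟨d, c, z.num, z.den, N, hd, rfl, hcop, hM, by exact_mod_cast z.den_ne_zero, ?_, ?_⟩
  · rw [hxz]
    push_cast
    rw [← hzz]
  · apply mul_left_cancel₀ hd0
    linear_combination hN

namespace IsShort

/-- Weak finiteness: the `x`-coordinates of rational points take finitely many values modulo
squares. -/
theorem exists_finite_squareLike {W : WeierstrassCurve ℚ} {b : ℤ} (h : IsShort W (b : ℚ)) :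
    ∃ S : Set W.toAffine.Point, S.Finite ∧ ∀ P, ∃ s ∈ S, SquareLike (P - s) := by
  classical
  have hb : b ≠ 0 := by
    rintro rfl; exact h.ne_zero (by simp)
  let cls : ℤ → W.toAffine.Point → Prop := fun d P =>
    ∃ x y hxy z, P = Point.some x y hxy ∧ z ≠ 0 ∧ d ≠ 0 ∧ x = d * z ^ 2
  -- One representative point for each occupied class; the default 0 is never used as one.
  let rep : ℤ → W.toAffine.Point := fun d => if H : ∃ P, cls d P then H.choose else 0
  have hfin : {d : ℤ | d ∣ b}.Finite :=
    (Set.finite_Icc (-|b|) |b|).subset fun d hd =>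
      abs_le.1 (Int.le_of_dvd (abs_pos.2 hb) (by rwa [abs_dvd_abs]))
  refine ⟨insert 0 (rep '' {d | d ∣ b}), (hfin.image _).insert _, fun P => ?_⟩
  rcases P with _ | ⟨x, y, hxy⟩
  · exact ⟨0, by simp, Or.inl (sub_zero _)⟩
  by_cases hx : x = 0
  · subst hx
    refine ⟨0, by simp, Or.inr ⟨0, y, by simpa using hxy, ?_⟩⟩
    rw [sub_zero]
    exact some_congr (by simp) rfl
  · obtain ⟨d, c, M, e, N, hd, hdc, -, hM, he, hxd, -⟩ :=
      exists_quartic hx (h.eq_of_nonsingular hxy)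
    have hM' : (M : ℚ) ≠ 0 := by exact_mod_cast hM
    have he' : (e : ℚ) ≠ 0 := by exact_mod_cast he
    have H : ∃ P, cls d P :=
      ⟨_, x, y, hxy, (M : ℚ) / e, rfl, div_ne_zero hM' he', hd.ne_zero, hxd⟩
    refine ⟨rep d, Or.inr ⟨d, ⟨c, hdc.symm⟩, rfl⟩, ?_⟩
    have hrep : rep d = H.choose := dif_pos H
    obtain ⟨x', y', hxy', z, hP, hz, -, hxz⟩ := H.choose_spec
    rw [hrep, hP]
    have hd' : (d : ℚ) ≠ 0 := by exact_mod_cast hd.ne_zero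
    refine h.squareLike_sub (z := d * ((M : ℚ) / e) * z) hxy hxy' ?_ ?_
    · exact mul_ne_zero (mul_ne_zero hd' (div_ne_zero hM' he')) hz
    · rw [hxd, hxz]; ring

end IsShort

namespace GaussianPair

variable {F K : Type*} [Field F] [Field K] [CharZero F] [DecidableEq F] [CharZero K]
  [DecidableEq K] (D : GaussianPair F K)

/-- The value `x = 0` counts as a square but is excluded from division by `1 + i`; the correction
`t` absorbs it. -/
theorem exists_of_squareLike {P : D.W.toAffine.Point} (hP : IsShort.SquareLike P) :
    ∃ t ∈ ({0, D.hW.origin} : Set D.W.toAffine.Point), ∃ Q,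
      D.incl (P - t) = D.incl' Q + D.mulI (D.incl' Q) := by
  rcases hP with rfl | ⟨w, y, h, rfl⟩
  · exact ⟨0, by simp, 0, by simp⟩
  · by_cases hw : w = 0
    · refine ⟨D.hW.origin, by simp, 0, ?_⟩
      rw [D.hW.some_zero_eq_origin h (by simp [hw])]
      simp
    · obtain ⟨Q, hQ⟩ := D.exists_one_add_i h hw
      exact ⟨0, by simp, Q, by rw [sub_zero, hQ]⟩

theorem exists_of_squareLike' {Q : D.W'.toAffine.Point} (hQ : IsShort.SquareLike Q) :
    ∃ t ∈ ({0, D.hW'.origin} : Set D.W'.toAffine.Point), ∃ R,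
      D.incl' (Q - t) = D.incl R - D.mulI (D.incl R) := by
  rcases hQ with rfl | ⟨w, y, h, rfl⟩
  · exact ⟨0, by simp, 0, by simp⟩
  · by_cases hw : w = 0
    · refine ⟨D.hW'.origin, by simp, 0, ?_⟩
      rw [D.hW'.some_zero_eq_origin h (by simp [hw])]
      simp
    · obtain ⟨R, hR⟩ := D.exists_one_sub_i h hw
      exact ⟨0, by simp, R, by rw [sub_zero, hR]⟩

/-- Two-descent via the isogenies `1 + i` and `1 - i`. -/
theorem exists_descent {S : Set D.W.toAffine.Point} {S' : Set D.W'.toAffine.Point}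
    (hS : ∀ P, ∃ s ∈ S, IsShort.SquareLike (P - s))
    (hS' : ∀ Q, ∃ s ∈ S', IsShort.SquareLike (Q - s)) (P : D.W.toAffine.Point) :
    ∃ s ∈ S, ∃ t ∈ ({0, D.hW.origin} : Set D.W.toAffine.Point), ∃ s' ∈ S', ∃ R,
      D.incl (P - (s + t) - (R + R)) = D.incl' s' + D.mulI (D.incl' s') := by
  obtain ⟨s, hs, hP⟩ := hS P
  obtain ⟨t, ht, Q, hQ⟩ := D.exists_of_squareLike hP
  obtain ⟨s', hs', hQ'⟩ := hS' Q
  obtain ⟨t', ht', R, hR⟩ := D.exists_of_squareLike' hQ'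
  refine ⟨s, hs, t, ht, s', hs', R, ?_⟩
  have h0 := D.mulI_add_of_origin t' ht'
  have hQe : D.incl' Q = D.incl' s' + D.incl' t' + (D.incl R - D.mulI (D.incl R)) := by
    rw [← hR, map_sub, map_sub]; abel
  -- `(1 + i)(1 - i)R = 2R`, while `(1 + i)t' = 0`.
  rw [← sub_sub P, map_sub, hQ, hQe, map_add, map_add, map_add, map_sub, D.mulI_mulI]
  have h1 : D.mulI (D.incl' t') = -D.incl' t' := by
    rw [eq_neg_iff_add_eq_zero, add_comm]; exact h0
  rw [h1]; abel

/-- The remainder `P - 2R` is rational and its image in `V(K)` is one of finitely many values `s + t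
+ (1 + i)s'`; injectivity of the inclusion bounds the remainders. -/
theorem exists_finite_add_two_nsmul {S : Set D.W.toAffine.Point} {S' : Set D.W'.toAffine.Point}
    (hSf : S.Finite) (hSf' : S'.Finite) (hS : ∀ P, ∃ s ∈ S, IsShort.SquareLike (P - s))
    (hS' : ∀ Q, ∃ s ∈ S', IsShort.SquareLike (Q - s)) :
    ∃ T : Set D.W.toAffine.Point, T.Finite ∧ ∀ P, ∃ s ∈ T, ∃ R, P = s + (R + R) := by
  let g : D.W.toAffine.Point × D.W.toAffine.Point × D.W'.toAffine.Point → D.V.toAffine.Point :=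
    fun q => D.incl (q.1 + q.2.1) + (D.incl' q.2.2 + D.mulI (D.incl' q.2.2))
  refine ⟨D.incl ⁻¹' (g '' (S ×ˢ ({0, D.hW.origin} ×ˢ S'))),
    ((hSf.prod ((Set.toFinite _).prod hSf')).image g).preimage D.incl_injective.injOn,
    fun P => ?_⟩
  obtain ⟨s, hs, t, ht, s', hs', R, hR⟩ := D.exists_descent hS hS' P
  refine ⟨P - (R + R), ⟨(s, t, s'), ⟨hs, ht, hs'⟩, ?_⟩, R, by abel⟩
  simp only [g]
  rw [← hR, ← map_add]
  congr 1
  abel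

end GaussianPair

/-- The Mordell–Weil theorem for the curves `y² = x³ + b x` over `ℚ`. -/
theorem GaussianPair.finite_points {K : Type*} [Field K] [CharZero K] [DecidableEq K]
    (D : GaussianPair ℚ K) {b : ℤ} (hb : D.b = b) : Module.Finite ℤ D.W.toAffine.Point := by
  have h : IsShort D.W (b : ℚ) := hb ▸ D.hW
  have h' : IsShort D.W' ((-4 * b : ℤ) : ℚ) := by
    have := D.hW'
    rw [hb] at this
    exact_mod_cast this
  obtain ⟨S, hSf, hS⟩ := h.exists_finite_squareLike
  obtain ⟨S', hSf', hS'⟩ := h'.exists_finite_squareLike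
  obtain ⟨T, hTf, hT⟩ := D.exists_finite_add_two_nsmul hSf hSf' hS hS'
  exact h.finite_of_descent hTf hT

end FiveP

/-! ### Rank comparison, rank doubling and rank bounds. -/

namespace FiveP

open WeierstrassCurve Affine Module

section AbelianGroups

variable {M N : Type*} [AddCommGroup M] [AddCommGroup N]

theorem finrank_eq_zero_of_two_torsion [Module.Finite ℤ M] (h : ∀ x : M, x + x = 0) :
    finrank ℤ M = 0 := by
  rw [finrank_eq_zero_iff_isTorsion]
  intro x
  refine ⟨⟨2, mem_nonZeroDivisors_of_ne_zero two_ne_zero⟩, ?_⟩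
  change (2 : ℤ) • x = 0
  rw [two_zsmul, h]

/-- A homomorphism whose kernel and cokernel are killed by two preserves the rank. -/
theorem finrank_eq_of_two_torsion [Module.Finite ℤ M] (g : M →ₗ[ℤ] N)
    (hker : ∀ x, g x = 0 → x + x = 0) (hrange : ∀ y, ∃ x, g x = y + y)
    (hfin : {y : N | y + y = 0}.Finite) :
    Module.Finite ℤ N ∧ finrank ℤ N = finrank ℤ M := by
  have hN : Module.Finite ℤ N := by
    -- Under multiplication by 2 the image lies in the Noetherian range of `g` and the kernel is
    -- finite.
    refine ⟨Submodule.fg_of_fg_map_of_fg_inf_ker (LinearMap.lsmul ℤ N 2) ?_ ?_⟩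
    · have hle : Submodule.map (LinearMap.lsmul ℤ N 2) ⊤ ≤ LinearMap.range g := by
        rintro _ ⟨y, -, rfl⟩
        obtain ⟨x, hx⟩ := hrange y
        exact ⟨x, by rw [hx, LinearMap.lsmul_apply, two_zsmul]⟩
      have : IsNoetherian ℤ (LinearMap.range g) := inferInstance
      exact (isNoetherian_submodule.1 this) _ hle
    · rw [top_inf_eq]
      have : Finite (LinearMap.ker (LinearMap.lsmul ℤ N 2)) := by
        refine Set.Finite.to_subtype (hfin.subset fun y hy => ?_)
        have : (2 : ℤ) • y = 0 := hy
        rwa [two_zsmul] at this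
      exact Module.Finite.iff_fg.1 inferInstance
  refine ⟨hN, ?_⟩
  have h1 := Submodule.finrank_quotient_add_finrank (LinearMap.range g)
  have h2 := Submodule.finrank_quotient_add_finrank (LinearMap.ker g)
  rw [g.quotKerEquivRange.finrank_eq] at h2
  have h3 : finrank ℤ (N ⧸ LinearMap.range g) = 0 := by
    refine finrank_eq_zero_of_two_torsion fun q => ?_
    induction q using Submodule.Quotient.induction_on with
    | H y =>
      obtain ⟨x, hx⟩ := hrange y
      rw [← Submodule.Quotient.mk_add, Submodule.Quotient.mk_eq_zero]
      exact ⟨x, hx⟩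
  have h4 : finrank ℤ (LinearMap.ker g) = 0 :=
    finrank_eq_zero_of_two_torsion fun x => Subtype.ext (hker x.1 x.2)
  omega

theorem finrank_prod_int [Module.Finite ℤ M] [Module.Finite ℤ N] :
    finrank ℤ (M × N) = finrank ℤ M + finrank ℤ N := by
  have h := Submodule.finrank_quotient_add_finrank (LinearMap.ker (LinearMap.snd ℤ M N))
  rw [((LinearMap.snd ℤ M N).quotKerEquivOfSurjective LinearMap.snd_surjective).finrank_eq,
    LinearMap.ker_snd,
    ← (LinearEquiv.ofInjective (LinearMap.inl ℤ M N) LinearMap.inl_injective).finrank_eq] at h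
  omega

/-- If the elements of `G` represent all classes modulo twice the group and torsion, then the rank
is at most the binary logarithm of the size of `G`. -/
theorem two_pow_finrank_le [Module.Finite ℤ M] {G : Set M} (hG : G.Finite)
    (H : ∀ x, ∃ g ∈ G, ∃ t r, t + t = 0 ∧ x = g + t + (r + r)) :
    2 ^ finrank ℤ M ≤ G.ncard := by
  let B := M ⧸ Submodule.torsion ℤ M
  have hB : finrank ℤ B = finrank ℤ M := by
    simp only [finrank]
    rw [rank_quotient_eq_of_le_torsion le_rfl]
  let e := (finBasis ℤ B).equivFun
  -- Coordinates modulo torsion, reduced mod 2: `t` and `2r` vanish, so `G` already surjects.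
  let φ : M → (Fin (finrank ℤ B) → ZMod 2) := fun x j => (e (Submodule.Quotient.mk x) j : ZMod 2)
  have hφ : ∀ x y, φ (x + y) = φ x + φ y := by
    intro x y; ext j
    simp [φ]
  have hsurj : Function.Surjective φ := by
    intro v
    obtain ⟨x, hx⟩ := Submodule.Quotient.mk_surjective (Submodule.torsion ℤ M)
      (e.symm fun j => ((v j).val : ℤ))
    refine ⟨x, ?_⟩
    ext j
    simp only [φ]
    rw [hx, LinearEquiv.apply_symm_apply]
    simp
  have ht : ∀ t : M, t + t = 0 → φ t = 0 := by
    intro t ht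
    have : (Submodule.Quotient.mk t : B) = 0 := by
      rw [Submodule.Quotient.mk_eq_zero]
      refine ⟨⟨2, mem_nonZeroDivisors_of_ne_zero two_ne_zero⟩, ?_⟩
      change (2 : ℤ) • t = 0
      rw [two_zsmul, ht]
    ext j
    simp only [φ]
    rw [this]
    simp
  have himage : φ '' G = Set.univ := by
    refine Set.eq_univ_of_forall fun v => ?_
    obtain ⟨x, rfl⟩ := hsurj v
    obtain ⟨g, hg, t, r, htt, rfl⟩ := H x
    refine ⟨g, hg, ?_⟩
    rw [hφ, hφ, hφ, ht t htt, add_zero]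
    ext j
    simp [CharTwo.add_self_eq_zero]
  have := Set.ncard_image_le (f := φ) hG
  rw [himage, Set.ncard_univ] at this
  simpa [hB] using this

theorem one_le_finrank [Module.Finite ℤ M] {x : M} (hx : ¬IsOfFinAddOrder x) :
    1 ≤ finrank ℤ M := by
  by_contra h0
  have h0 : finrank ℤ M = 0 := by omega
  obtain ⟨⟨n, hn⟩, h⟩ := finrank_eq_zero_iff_isTorsion.1 h0 (x := x)
  exact hx (isOfFinAddOrder_iff_zsmul_eq_zero.2 ⟨n, nonZeroDivisors.ne_zero hn, h⟩)

theorem add_self_of_mem {T s : M} (hT : T + T = 0) (hs : s ∈ ({0, T} : Set M)) : s + s = 0 := by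
  rcases hs with rfl | rfl
  · exact add_zero 0
  · exact hT

end AbelianGroups

theorem IsShort.finite_two_torsion {F : Type*} [Field F] [CharZero F] [DecidableEq F]
    {W : WeierstrassCurve F} {b : F} (h : IsShort W b) :
    {P : W.toAffine.Point | P + P = 0}.Finite := by
  have hroot : {x : F | x ^ 2 = -b}.Finite := by
    by_cases hx : ∃ x : F, x ^ 2 = -b
    · obtain ⟨x, hx⟩ := hx
      refine (Set.toFinite {x, -x}).subset fun y (hy : y ^ 2 = -b) => ?_
      exact sq_eq_sq_iff_eq_or_eq_neg.1 (hy.trans hx.symm)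
    · push Not at hx
      convert Set.finite_empty
      ext x; simpa using hx x
  refine Set.Finite.of_finite_fibers Point.xRep ?_ ?_
  · refine ((((hroot.insert 0).image fun x => ![x, 1])).insert ![1, 0]).subset ?_
    rintro _ ⟨_ | ⟨x, y, hxy⟩, hP, rfl⟩
    · left; rfl
    · right
      refine ⟨x, ?_, rfl⟩
      have hy := h.y_eq_zero_of_add_self_eq_zero hxy hP
      have E := h.eq_of_nonsingular hxy
      have hx : x * (x ^ 2 + b) = 0 := by rw [hy] at E; linear_combination -E
      rcases mul_eq_zero.1 hx with hx | hx
      · left; exact hx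
      · right; exact eq_neg_of_add_eq_zero_left hx
  · rintro _ ⟨P, -, rfl⟩
    refine Set.Finite.subset (Set.toFinite {P, -P}) ?_
    rintro Q ⟨-, hQ⟩
    exact Point.eq_or_eq_neg_of_xRep_eq_xRep hQ

namespace GaussianPair

variable {F K : Type*} [Field F] [Field K] [CharZero F] [DecidableEq F] [CharZero K]
  [DecidableEq K] (D : GaussianPair F K)

/-- If `K / F` has a conjugation with fixed field `F` which sends `i` to `-i`, then the rank of
`y² = x³ + b x` doubles in passing from `F` to `K`. -/
theorem finrank_eq (σ : K →+* K) (hσ : ∀ z, σ (σ z) = z) (hi : σ D.i = -D.i)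
    (hf : ∀ a, σ (D.f a) = D.f a)
    (hfix : ∀ z, σ z = z → ∃ a, D.f a = z) [Module.Finite ℤ D.W.toAffine.Point] :
    Module.Finite ℤ D.V.toAffine.Point ∧
      finrank ℤ D.V.toAffine.Point = 2 * finrank ℤ D.W.toAffine.Point := by
  let conj : D.V.toAffine.Point →+ D.V.toAffine.Point :=
    scaleHom D.hV D.hV σ 1 one_ne_zero (by rw [hf]; ring)
  have conj_some : ∀ x y h, ∃ h', conj (.some x y h) = .some (σ x) (σ y) h' := by
    intro x y h
    have : ∃ h', conj (.some x y h) = .some (1 ^ 2 * σ x) (1 ^ 3 * σ y) h' := ⟨_, rfl⟩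
    simpa only [one_pow, one_mul] using this
  have conj_incl : ∀ A, conj (D.incl A) = D.incl A := by
    rintro (_ | ⟨x, y, h⟩)
    · rfl
    · obtain ⟨h₁, e₁⟩ := D.incl_some h
      obtain ⟨h₂, e₂⟩ := conj_some _ _ h₁
      rw [e₁, e₂]
      exact IsShort.some_congr (hf x) (hf y)
  have conj_mulI : ∀ P, conj (D.mulI P) = -D.mulI (conj P) := by
    rintro (_ | ⟨x, y, h⟩)
    · rfl
    · obtain ⟨h₁, e₁⟩ := D.mulI_some h
      obtain ⟨h₂, e₂⟩ := conj_some _ _ h₁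
      obtain ⟨h₃, e₃⟩ := conj_some _ _ h
      obtain ⟨h₄, e₄⟩ := D.mulI_some h₃
      obtain ⟨h₅, e₅⟩ := D.hV.neg_some h₄
      rw [e₁, e₂, e₃, e₄, e₅]
      exact IsShort.some_congr (map_neg σ x) (by rw [map_mul, hi, neg_mul])
  have fix : ∀ P, conj P = P → ∃ A, D.incl A = P := by
    rintro (_ | ⟨x, y, h⟩) hP
    · exact ⟨0, map_zero _⟩
    · obtain ⟨h₁, e₁⟩ := conj_some _ _ h
      rw [e₁, Point.some.injEq] at hP
      obtain ⟨x, rfl⟩ := hfix x hP.1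
      obtain ⟨y, rfl⟩ := hfix y hP.2
      have E := D.hV.eq_of_nonsingular h
      simp only [← map_mul, ← map_pow, ← map_add, D.f.injective.eq_iff] at E
      exact ⟨.some x y (D.hW.nonsingular E), (D.incl_some _).2⟩
  have conj_conj : ∀ P, conj (conj P) = P := by
    rintro (_ | ⟨x, y, h⟩)
    · rfl
    · obtain ⟨h₁, e₁⟩ := conj_some _ _ h
      obtain ⟨h₂, e₂⟩ := conj_some _ _ h₁
      rw [e₁, e₂]
      exact IsShort.some_congr (hσ x) (hσ y)
  let g : D.W.toAffine.Point × D.W.toAffine.Point →+ D.V.toAffine.Point :=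
    AddMonoidHom.coprod D.incl (D.mulI.comp D.incl)
  have hg : ∀ A B, g (A, B) = D.incl A + D.mulI (D.incl B) := fun A B => rfl
  have := finrank_eq_of_two_torsion g.toIntLinearMap ?_ ?_ D.hV.finite_two_torsion
  · rwa [finrank_prod_int, ← two_mul] at this
  · rintro ⟨A, B⟩ (h0 : g (A, B) = 0)
    rw [hg] at h0
    have h1 := congrArg conj h0
    rw [map_add, conj_incl, conj_mulI, conj_incl, map_zero] at h1
    -- Conjugating `A + iB = 0` gives `A - iB = 0`; add and subtract.
    have hA : D.incl A + D.incl A = 0 := by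
      calc _ = (D.incl A + D.mulI (D.incl B)) + (D.incl A + -D.mulI (D.incl B)) := by abel
        _ = 0 := by rw [h0, h1, add_zero]
    have hB : D.mulI (D.incl B) + D.mulI (D.incl B) = 0 := by
      calc _ = (D.incl A + D.mulI (D.incl B)) - (D.incl A + -D.mulI (D.incl B)) := by abel
        _ = 0 := by rw [h0, h1, sub_zero]
    have hB' := congrArg (fun P => -D.mulI P) hB
    simp only [map_add, D.mulI_mulI, map_zero, neg_zero, neg_add, neg_neg] at hB'
    refine Prod.ext (D.incl_injective ?_) (D.incl_injective ?_)
    · simpa using hA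
    · simpa using hB'
  · intro P
    -- `2P = (P + P̄) + (P - P̄)`, where `P + P̄` and `i(P - P̄)` are fixed by conjugation, hence
    -- rational.
    obtain ⟨A, hA⟩ := fix (P + conj P) (by rw [map_add, conj_conj, add_comm])
    obtain ⟨B, hB⟩ := fix (D.mulI (P - conj P)) (by
      rw [conj_mulI, map_sub, conj_conj, ← map_neg, neg_sub])
    refine ⟨(A, -B), ?_⟩
    change g (A, -B) = _
    rw [hg, hA, map_neg, map_neg, hB, D.mulI_mulI]
    abel

section Selmer

variable {F K : Type*} [Field F] [Field K] [CharZero F] [DecidableEq F] [CharZero K]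
  [DecidableEq K] (D : GaussianPair F K) [Module.Finite ℤ D.W.toAffine.Point]

/-- Every remainder `s + t` is 2-torsion and `(1 + i)s' = 0`, so each point is 2-torsion plus a
double. -/
theorem finrank_eq_zero_of_squareLike
    (hS : ∀ P, ∃ s ∈ ({0, D.hW.origin} : Set D.W.toAffine.Point), IsShort.SquareLike (P - s))
    (hS' : ∀ Q, ∃ s ∈ ({0, D.hW'.origin} : Set D.W'.toAffine.Point),
      IsShort.SquareLike (Q - s)) :
    finrank ℤ D.W.toAffine.Point = 0 := by
  have hle : 2 ^ finrank ℤ D.W.toAffine.Point ≤ ({0} : Set D.W.toAffine.Point).ncard := by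
    refine two_pow_finrank_le (Set.finite_singleton _) fun P => ?_
    obtain ⟨s, hs, t, ht, s', hs', R, hR⟩ := D.exists_descent hS hS' P
    rw [D.mulI_add_of_origin s' hs', map_eq_zero_iff _ D.incl_injective] at hR
    have hs2 := add_self_of_mem D.hW.origin_add_origin hs
    have ht2 := add_self_of_mem D.hW.origin_add_origin ht
    refine ⟨0, rfl, s + t, R, ?_, ?_⟩
    · rw [add_add_add_comm, hs2, ht2, add_zero]
    · rw [zero_add, ← sub_eq_zero, ← sub_sub]
      exact hR
  rw [Set.ncard_singleton] at hle
  by_contra h0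
  have := Nat.one_lt_two_pow h0
  omega

theorem finrank_le_one_of_squareLike (Q₀ : D.W'.toAffine.Point)
    (hS : ∀ P, ∃ s ∈ ({0, D.hW.origin} : Set D.W.toAffine.Point), IsShort.SquareLike (P - s))
    (hS' : ∀ Q, ∃ s ∈ ({0, D.hW'.origin} : Set D.W'.toAffine.Point),
      IsShort.SquareLike (Q - s) ∨ IsShort.SquareLike (Q - s - Q₀)) :
    finrank ℤ D.W.toAffine.Point ≤ 1 := by
  let ψ : D.W'.toAffine.Point → D.V.toAffine.Point := fun Q => D.incl' Q + D.mulI (D.incl' Q)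
  have ψ_add : ∀ Q s, s ∈ ({0, D.hW'.origin} : Set _) → ψ (Q + s) = ψ Q := by
    intro Q s hs
    have := D.mulI_add_of_origin s hs
    calc ψ (Q + s) = ψ Q + (D.incl' s + D.mulI (D.incl' s)) := by
          simp only [ψ, map_add]; abel
      _ = ψ Q := by rw [this, add_zero]
  have ψ_zero : ψ 0 = 0 := by simp [ψ]
  -- Only `(1 + i)s'` matters in the descent; it takes two values, whence `2 ^ rank ≤ 2`.
  let S' : Set D.W'.toAffine.Point := {Q | ψ Q = 0 ∨ ψ Q = ψ Q₀}
  have hS'' : ∀ Q : D.W'.toAffine.Point, ∃ s ∈ S', IsShort.SquareLike (Q - s) := by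
    intro Q
    obtain ⟨s, hs, h | h⟩ := hS' Q
    · refine ⟨s, Or.inl ?_, h⟩
      rw [← zero_add s, ψ_add 0 s hs, ψ_zero]
    · refine ⟨Q₀ + s, Or.inr (ψ_add _ _ hs), ?_⟩
      rwa [add_comm, ← sub_sub]
  let G : Set D.W.toAffine.Point := D.incl ⁻¹' {0, ψ Q₀}
  have hG : G.ncard ≤ 2 := by
    refine (Set.ncard_le_ncard_of_injOn D.incl (t := {0, ψ Q₀}) (fun _ h => h)
      D.incl_injective.injOn (Set.toFinite _)).trans ((Set.ncard_insert_le _ _).trans ?_)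
    rw [Set.ncard_singleton]
  have hle : 2 ^ finrank ℤ D.W.toAffine.Point ≤ G.ncard := by
    refine two_pow_finrank_le ((Set.toFinite _).preimage D.incl_injective.injOn) fun P => ?_
    obtain ⟨s, hs, t, ht, s', hs', R, hR⟩ := D.exists_descent hS hS'' P
    have hs2 := add_self_of_mem D.hW.origin_add_origin hs
    have ht2 := add_self_of_mem D.hW.origin_add_origin ht
    refine ⟨P - (s + t) - (R + R), ?_, s + t, R, ?_, ?_⟩
    · change D.incl _ ∈ ({0, ψ Q₀} : Set _)
      rw [hR]
      exact hs'
    · rw [add_add_add_comm, hs2, ht2, add_zero]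
    · abel
  by_contra! h2
  have := Nat.pow_le_pow_right (n := 2) (by norm_num) h2
  omega

end Selmer

end GaussianPair

end FiveP

/-! ### Local conditions on the quartics. -/

namespace FiveP

open WeierstrassCurve Affine Module

/-- Modulo `q` the quartic reads `N² = d M⁴`. If `q ∣ M`, then `q ∣ N` and `q² ∣ c e⁴` with `e`
prime to `q`, contradicting `q² ∤ c`. -/
theorem isSquare_of_quartic {q : ℕ} (hq : q.Prime) {d c M e N : ℤ} (hMe : IsCoprime M e)
    (h : N ^ 2 = d * M ^ 4 + c * e ^ 4) (hc : (q : ℤ) ∣ c) (hc2 : ¬(q : ℤ) ^ 2 ∣ c) :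
    IsSquare (d : ZMod q) := by
  have : Fact q.Prime := ⟨hq⟩
  have hqZ : Prime (q : ℤ) := Nat.prime_iff_prime_int.1 hq
  by_cases hM : (q : ℤ) ∣ M
  · exfalso
    have hN : (q : ℤ) ∣ N := by
      refine hqZ.dvd_of_dvd_pow (n := 2) ?_
      rw [h]
      exact dvd_add (dvd_mul_of_dvd_right (dvd_pow hM (by norm_num)) _) (dvd_mul_of_dvd_left hc _)
    have h2 : (q : ℤ) ^ 2 ∣ c * e ^ 4 := by
      have h3 : c * e ^ 4 = N ^ 2 - d * M ^ 4 := by linear_combination -h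
      rw [h3]
      refine dvd_sub (pow_dvd_pow_of_dvd hN 2) (dvd_mul_of_dvd_right ?_ _)
      exact (pow_dvd_pow _ (by norm_num)).trans (pow_dvd_pow_of_dvd hM 4)
    have hcop : IsCoprime (q : ℤ) e := hMe.of_isCoprime_of_dvd_left hM
    exact hc2 ((hcop.pow (m := 2) (n := 4)).dvd_of_dvd_mul_right h2)
  · have hM' : (M : ZMod q) ≠ 0 := by rwa [Ne, ZMod.intCast_zmod_eq_zero_iff_dvd]
    have hc' : (c : ZMod q) = 0 := by rwa [ZMod.intCast_zmod_eq_zero_iff_dvd]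
    have h' := congrArg (Int.cast : ℤ → ZMod q) h
    push_cast at h'
    rw [hc', zero_mul, add_zero] at h'
    refine ⟨N / M ^ 2, ?_⟩
    field_simp
    linear_combination -h'

section Primes

variable {p : ℕ}

theorem not_isSquare_mod_five (h5 : p % 5 = 2 ∨ p % 5 = 3) : ¬IsSquare (p : ZMod 5) := by
  rcases h5 with h | h
  · rw [show (p : ZMod 5) = (2 : ℕ) from (ZMod.natCast_eq_natCast_iff' _ _ _).2 h]; decide
  · rw [show (p : ZMod 5) = (3 : ℕ) from (ZMod.natCast_eq_natCast_iff' _ _ _).2 h]; decide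

theorem not_isSquare_five (hp : p.Prime) (h4 : p % 4 = 3) (h5 : p % 5 = 2 ∨ p % 5 = 3) :
    ¬IsSquare (5 : ZMod p) := by
  have : Fact p.Prime := ⟨hp⟩
  have : Fact (Nat.Prime 5) := ⟨by norm_num⟩
  have := ZMod.exists_sq_eq_prime_iff_of_mod_four_eq_one (p := 5) (q := p) (by norm_num)
    (by omega)
  rw [Nat.cast_ofNat] at this
  rw [← this]
  exact not_isSquare_mod_five h5

theorem not_isSquare_ten (hp : p.Prime) (h8 : p % 8 = 7) (h5 : p % 5 = 2 ∨ p % 5 = 3) :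
    ¬IsSquare (10 : ZMod p) := by
  have : Fact p.Prime := ⟨hp⟩
  have h2 : IsSquare (2 : ZMod p) :=
    (ZMod.exists_sq_eq_two_iff (by omega)).2 (Or.inr h8)
  have h20 : (2 : ZMod p) ≠ 0 := by
    intro h0
    have h0 : ((2 : ℕ) : ZMod p) = 0 := by exact_mod_cast h0
    rw [ZMod.natCast_eq_zero_iff] at h0
    have := Nat.le_of_dvd (by norm_num) h0
    interval_cases p <;> omega
  intro h
  refine not_isSquare_five hp (by omega) h5 ?_
  have := h.div h2
  rwa [show (10 : ZMod p) = 5 * 2 by norm_num, mul_div_cancel_right₀ _ h20] at this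

/-- A factorisation of `k p` splits off `p` from exactly one factor. -/
theorem exists_factorisation {d c k : ℤ} (hp : p.Prime) (h : d * c = k * p) :
    (∃ γ, c = γ * p ∧ d * γ = k) ∨ ∃ δ, d = δ * p ∧ δ * c = k := by
  have hpZ : Prime (p : ℤ) := Nat.prime_iff_prime_int.1 hp
  rcases hpZ.dvd_or_dvd (Dvd.intro_left k h.symm) with ⟨δ, rfl⟩ | ⟨γ, rfl⟩
  · refine Or.inr ⟨δ, mul_comm _ _, mul_right_cancel₀ hpZ.ne_zero ?_⟩
    linear_combination h
  · refine Or.inl ⟨γ, mul_comm _ _, mul_right_cancel₀ hpZ.ne_zero ?_⟩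
    linear_combination h

variable {d c M e N : ℤ}

/-- Of the eight divisors, `-1` and `5p` fail because `-1` is not a square mod `p`, `5` and `-p`
because 5 is not, `-5` and `p` because `p` is not a square mod 5. -/
theorem class_of_quartic (hp : p.Prime) (h4 : p % 4 = 3) (h5 : p % 5 = 2 ∨ p % 5 = 3)
    (hdc : d * c = -5 * p) (hMe : IsCoprime M e) (h : N ^ 2 = d * M ^ 4 + c * e ^ 4) :
    d = 1 ∨ d = -5 * p := by
  have h' : N ^ 2 = c * e ^ 4 + d * M ^ 4 := by rw [h]; ring
  have : Fact p.Prime := ⟨hp⟩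
  have hneg : ¬IsSquare (-1 : ZMod p) := by
    rw [ZMod.exists_sq_eq_neg_one_iff]; simpa using h4
  have hfive := not_isSquare_five hp h4 h5
  have hmod := not_isSquare_mod_five h5
  have hndvd : ∀ k : ℤ, k ∣ 5 → ¬(p : ℤ) ^ 2 ∣ k * p := by
    intro k hk hh
    rw [sq, mul_dvd_mul_iff_right (by exact_mod_cast hp.ne_zero)] at hh
    have := Int.le_of_dvd (by norm_num) (hh.trans hk)
    have h2 := hp.two_le
    have : p ≤ 5 := by exact_mod_cast this
    have hk5 := hh.trans hk
    interval_cases p <;> omega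
  have atp : ∀ k : ℤ, k ∣ 5 → c = k * p → IsSquare (d : ZMod p) := fun k hk hc =>
    isSquare_of_quartic hp hMe h (hc ▸ dvd_mul_left _ _) (hc ▸ hndvd k hk)
  have atp' : ∀ k : ℤ, k ∣ 5 → d = k * p → IsSquare (c : ZMod p) := fun k hk hd =>
    isSquare_of_quartic hp hMe.symm h' (hd ▸ dvd_mul_left _ _) (hd ▸ hndvd k hk)
  have at5 : (5 : ℤ) ∣ c → ¬(5 : ℤ) ^ 2 ∣ c → IsSquare (d : ZMod 5) := fun h1 h2 =>
    isSquare_of_quartic (by norm_num) hMe h h1 h2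
  have at5' : (5 : ℤ) ∣ d → ¬(5 : ℤ) ^ 2 ∣ d → IsSquare (c : ZMod 5) := fun h1 h2 =>
    isSquare_of_quartic (by norm_num) hMe.symm h' h1 h2
  have divs : ∀ a b : ℤ, a * b = -5 →
      a = 1 ∧ b = -5 ∨ a = -1 ∧ b = 5 ∨ a = 5 ∧ b = -1 ∨ a = -5 ∧ b = 1 := by
    intro a b hab
    have h1 : a ∣ 5 := ⟨-b, by linear_combination hab⟩
    have h2 := Int.le_of_dvd (by norm_num) h1
    have h3 := Int.le_of_dvd (by norm_num) ((neg_dvd (a := a)).2 h1)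
    have h4 : -5 ≤ a := by omega
    interval_cases a <;> omega
  rcases exists_factorisation hp hdc with ⟨γ, hc, hk⟩ | ⟨δ, hd, hk⟩
  · rcases divs _ _ hk with ⟨rfl, rfl⟩ | ⟨rfl, rfl⟩ | ⟨rfl, rfl⟩ | ⟨rfl, rfl⟩
    · exact Or.inl rfl
    · exact (hneg (by simpa using atp 5 (by norm_num) hc)).elim
    · exact (hfive (by simpa using atp (-1) (by norm_num) hc)).elim
    · refine (hmod ?_).elim
      have := at5' (by norm_num) (by norm_num)
      rw [hc] at this
      simpa using this
  · rcases divs _ _ hk with ⟨rfl, rfl⟩ | ⟨rfl, rfl⟩ | ⟨rfl, rfl⟩ | ⟨rfl, rfl⟩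
    · refine (hmod ?_).elim
      have := at5 (by norm_num) (by norm_num)
      rw [hd] at this
      simpa using this
    · exact (hfive (by simpa using atp' (-1) (by norm_num) hd)).elim
    · exact (hneg (by simpa using atp' 5 (by norm_num) hd)).elim
    · exact Or.inr hd

/-- The real place forces `d > 0`, and squarefreeness excludes multiples of 4. Modulo 5, the
nonsquare 2 rules out `2` and `10p`, the nonsquare `p` rules out `5` and `p`. -/
theorem class_of_quartic' (hp : p.Prime) (h4 : p % 4 = 3) (h5 : p % 5 = 2 ∨ p % 5 = 3)
    (hdsq : Squarefree d) (hdc : d * c = 20 * p) (hMe : IsCoprime M e) (hM : M ≠ 0)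
    (h : N ^ 2 = d * M ^ 4 + c * e ^ 4) :
    d = 1 ∨ d = 5 * p ∨ ((d = 10 ∨ d = 2 * p) ∧ IsSquare (10 : ZMod p)) := by
  have h' : N ^ 2 = c * e ^ 4 + d * M ^ 4 := by rw [h]; ring
  have hp0 : (0 : ℤ) < p := by exact_mod_cast hp.pos
  have hdpos : 0 < d := by
    rcases lt_trichotomy d 0 with hd | hd | hd
    · have hc : c < 0 := by nlinarith
      have h1 : 0 < M ^ 4 := by positivity
      have h2 : 0 ≤ e ^ 4 := by positivity
      nlinarith [sq_nonneg N]
    · rw [hd] at hdc; omega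
    · exact hd
  have hmod := not_isSquare_mod_five h5
  have hp5 : ¬(5 : ℤ) ∣ p := by omega
  have hndvd : ∀ k : ℤ, k ∣ 10 → ¬(p : ℤ) ^ 2 ∣ k * p := by
    intro k hk hh
    rw [sq, mul_dvd_mul_iff_right hp0.ne'] at hh
    have hk5 := hh.trans hk
    have := Int.le_of_dvd (by norm_num) hk5
    have : p ≤ 10 := by exact_mod_cast this
    interval_cases p <;> omega
  have at5 : (5 : ℤ) ∣ c → ¬(5 : ℤ) ^ 2 ∣ c → IsSquare (d : ZMod 5) := fun h1 h2 =>
    isSquare_of_quartic (by norm_num) hMe h h1 h2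
  have at5' : (5 : ℤ) ∣ d → ¬(5 : ℤ) ^ 2 ∣ d → IsSquare (c : ZMod 5) := fun h1 h2 =>
    isSquare_of_quartic (by norm_num) hMe.symm h' h1 h2
  have divs : ∀ a b : ℤ, 0 < a → a * b = 20 →
      a = 1 ∧ b = 20 ∨ a = 2 ∧ b = 10 ∨ a = 4 ∧ b = 5 ∨ a = 5 ∧ b = 4 ∨ a = 10 ∧ b = 2 ∨
        a = 20 ∧ b = 1 := by
    intro a b ha hab
    have h2 := Int.le_of_dvd (by norm_num) (Dvd.intro _ hab)
    interval_cases a <;> omega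
  have sqf : ∀ k : ℤ, d = 4 * k → False := by
    rintro k hk
    have := hdsq 2 ⟨k, by rw [hk]; ring⟩
    rw [Int.isUnit_iff] at this
    omega
  have two5 : ¬IsSquare (2 : ZMod 5) := by decide
  rcases exists_factorisation hp hdc with ⟨γ, hc, hk⟩ | ⟨δ, hd, hk⟩
  · rcases divs _ _ hdpos hk with ⟨hd, rfl⟩ | ⟨hd, rfl⟩ | ⟨hd, rfl⟩ | ⟨hd, rfl⟩ | ⟨hd, rfl⟩ |
      ⟨hd, rfl⟩
    · exact Or.inl hd
    · have := at5 (by omega) (by omega)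
      rw [hd] at this
      exact (two5 (by simpa using this)).elim
    · exact (sqf 1 hd).elim
    · have := at5' (by omega) (by omega)
      rw [hc] at this
      refine (hmod ?_).elim
      obtain ⟨r, hr⟩ := this
      push_cast at hr
      have h35 : (35 : ZMod 5) = 0 := by decide
      -- From `4p = r²`, since `9 · 4 ≡ 1 mod 5`.
      exact ⟨3 * r, by linear_combination 9 * hr - p * h35⟩
    · refine Or.inr (Or.inr ⟨Or.inl hd, ?_⟩)
      have := isSquare_of_quartic hp hMe h (hc ▸ dvd_mul_left _ _) (hc ▸ hndvd 2 (by norm_num))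
      rw [hd] at this
      simpa using this
    · exact (sqf 5 hd).elim
  · have hδ : 0 < δ := by
      rw [hd] at hdpos; exact pos_of_mul_pos_left hdpos hp0.le
    rcases divs _ _ hδ hk with ⟨rfl, hc⟩ | ⟨rfl, hc⟩ | ⟨rfl, hc⟩ | ⟨rfl, hc⟩ | ⟨rfl, hc⟩ |
      ⟨rfl, hc⟩
    · have := at5 (by omega) (by omega)
      rw [hd] at this
      exact (hmod (by simpa using this)).elim
    · refine Or.inr (Or.inr ⟨Or.inr hd, ?_⟩)
      have := isSquare_of_quartic hp hMe.symm h' (hd ▸ dvd_mul_left _ _)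
        (hd ▸ hndvd 2 (by norm_num))
      rw [hc] at this
      simpa using this
    · exact (sqf p hd).elim
    · exact Or.inr (Or.inl hd)
    · have := at5' (by omega) (by omega)
      rw [hc] at this
      exact (two5 (by simpa using this)).elim
    · exact (sqf (5 * p) (by rw [hd]; ring)).elim

end Primes

namespace IsShort

/-! ### Points of infinite order from 2-adic denominators. -/

section TwoAdic

variable {W : WeierstrassCurve ℚ} {b : ℤ}

/-- If `v(x) < 0` then `v(x² ± b) = 2v(x)` and `2v(y) = 3v(x)`, so doubling lowers the valuation of
`x` by exactly 2. -/
theorem exists_double_padicValRat (h : IsShort W (b : ℚ)) {x y : ℚ}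
    (hxy : W.toAffine.Nonsingular x y) (hv : padicValRat 2 x < 0) :
    ∃ x' y' h', Point.some x y hxy + Point.some x y hxy = Point.some x' y' h' ∧
      padicValRat 2 x' < padicValRat 2 x := by
  have E := h.eq_of_nonsingular hxy
  have hx : x ≠ 0 := by rintro rfl; simp at hv
  have hvx2 : padicValRat 2 (x ^ 2) = 2 * padicValRat 2 x := by
    rw [padicValRat.pow]; norm_num
  have key : ∀ a : ℤ, a ≠ 0 → x ^ 2 + a ≠ 0 ∧ padicValRat 2 (x ^ 2 + a) = 2 * padicValRat 2 x := by
    intro a ha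
    have hva : 0 ≤ padicValRat 2 (a : ℚ) := by rw [padicValRat.of_int]; positivity
    have hne : x ^ 2 + a ≠ 0 := by
      intro h0
      have h1 : x ^ 2 = -(a : ℚ) := by linear_combination h0
      rw [h1, padicValRat.neg] at hvx2
      omega
    refine ⟨hne, ?_⟩
    rw [padicValRat.add_eq_of_lt hne (pow_ne_zero 2 hx) (by exact_mod_cast ha) (by omega), hvx2]
  have hb : b ≠ 0 := by
    rintro rfl; exact h.ne_zero (by simp)
  obtain ⟨h1, h2⟩ := key b hb
  obtain ⟨h3, h4⟩ := key (-b) (neg_ne_zero.2 hb)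
  have E' : y ^ 2 = x * (x ^ 2 + b) := by linear_combination E
  have hy : y ≠ 0 := by
    rintro rfl
    exact mul_ne_zero hx h1 (by rw [← E']; ring)
  have hvy : 2 * padicValRat 2 y = 3 * padicValRat 2 x := by
    have := congrArg (padicValRat 2) E'
    rw [padicValRat.pow, padicValRat.mul hx h1, h2] at this
    push_cast at this
    linarith
  obtain ⟨Y, h', e⟩ := h.double hxy hy
  refine ⟨_, Y, h', e, ?_⟩
  have h3' : x ^ 2 - (b : ℚ) ≠ 0 := by push_cast at h3; rwa [← sub_eq_add_neg] at h3
  have h4' : padicValRat 2 (x ^ 2 - (b : ℚ)) = 2 * padicValRat 2 x := by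
    push_cast at h4; rwa [← sub_eq_add_neg] at h4
  have hv2 : padicValRat 2 (2 : ℚ) = 1 := padicValRat.self (by norm_num)
  rw [padicValRat.pow,
    padicValRat.div h3' (mul_ne_zero two_ne_zero hy), padicValRat.mul two_ne_zero hy, h4', hv2]
  push_cast
  linarith

/-- Rational points of finite order are integral at two. -/
theorem not_isOfFinAddOrder (h : IsShort W (b : ℚ)) {x y : ℚ}
    (hxy : W.toAffine.Nonsingular x y) (hv : padicValRat 2 x < 0) :
    ¬IsOfFinAddOrder (Point.some x y hxy) := by
  intro hfin
  have step : ∀ n : ℕ, ∃ x' y' h', 2 ^ n • Point.some x y hxy = Point.some x' y' h' ∧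
      padicValRat 2 x' < -n := by
    intro n
    induction n with
    | zero => exact ⟨x, y, hxy, by simp, by simpa using hv⟩
    | succ n ih =>
      obtain ⟨x', y', h', e, hlt⟩ := ih
      obtain ⟨x'', y'', h'', e', hlt'⟩ := h.exists_double_padicValRat h' (by omega)
      refine ⟨x'', y'', h'', ?_, by push_cast; omega⟩
      rw [pow_succ, mul_comm, mul_nsmul', e, two_nsmul, e']
  let val : W.toAffine.Point → ℤ := fun P => padicValRat 2 (P.xRep 0)
  have hmul : (AddSubmonoid.multiples (Point.some x y hxy) : Set W.toAffine.Point).Finite :=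
    finite_multiples.2 hfin
  obtain ⟨B, hB⟩ := (hmul.image val).bddBelow
  obtain ⟨x', y', h', e, hlt⟩ := step B.natAbs
  have := hB ⟨_, ⟨2 ^ B.natAbs, e⟩, rfl⟩
  have hval : val (Point.some x' y' h') = padicValRat 2 x' := rfl
  rw [hval] at this
  omega

end TwoAdic

end IsShort

end FiveP

/-! ### The field `ℚ(i)` and the curves `E_p`. -/

namespace FiveP

open WeierstrassCurve Affine Module

section GaussianField

theorem I_mem : Complex.I ∈ IntermediateField.adjoin ℚ ({Complex.I} : Set ℂ) :=
  IntermediateField.mem_adjoin_simple_self ℚ _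

/-- The imaginary unit of `ℚ(i)`. -/
noncomputable def iQI : QI := ⟨Complex.I, I_mem⟩

theorem iQI_sq : iQI ^ 2 = -1 := Subtype.ext (by simp [iQI])

theorem exists_eq_add_mul_I (z : QI) : ∃ a b : ℚ, (z : ℂ) = a + b * Complex.I := by
  have hint : _root_.IsIntegral ℚ Complex.I :=
    ⟨Polynomial.X ^ 2 + 1, by monicity!, by simp⟩
  have hz : (z : ℂ) ∈ Algebra.adjoin ℚ ({Complex.I} : Set ℂ) := by
    rw [← IntermediateField.adjoin_simple_toSubalgebra_of_isAlgebraic hint.isAlgebraic]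
    exact z.2
  generalize (z : ℂ) = w at hz
  induction hz using Algebra.adjoin_induction with
  | mem x hx => exact ⟨0, 1, by simpa using hx⟩
  | algebraMap r => exact ⟨r, 0, by simp⟩
  | add x y _ _ hx hy =>
    obtain ⟨a, b, rfl⟩ := hx
    obtain ⟨c, d, rfl⟩ := hy
    exact ⟨a + c, b + d, by push_cast; ring⟩
  | mul x y _ _ hx hy =>
    obtain ⟨a, b, rfl⟩ := hx
    obtain ⟨c, d, rfl⟩ := hy
    exact ⟨a * c - b * d, a * d + b * c, by
      push_cast; linear_combination (b * d : ℂ) * Complex.I_sq⟩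

/-- Complex conjugation on `ℚ(i)`. -/
noncomputable def conjQI : QI →+* QI :=
  ((starRingEnd ℂ).comp (algebraMap QI ℂ)).codRestrict
    (IntermediateField.adjoin ℚ ({Complex.I} : Set ℂ)).toSubfield.toSubring (fun z => by
      obtain ⟨a, b, h⟩ := exists_eq_add_mul_I z
      have : ((starRingEnd ℂ).comp (algebraMap QI ℂ)) z =
          ((a : QI) - (b : QI) * iQI : QI) := by
        change (starRingEnd ℂ) (z : ℂ) = _
        rw [h]
        simp [iQI, sub_eq_add_neg]
      rw [this]
      exact SetLike.coe_mem _)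

theorem coe_conjQI (z : QI) : (conjQI z : ℂ) = (starRingEnd ℂ) z := rfl

theorem conjQI_conjQI (z : QI) : conjQI (conjQI z) = z :=
  Subtype.ext (by rw [coe_conjQI, coe_conjQI, Complex.conj_conj])

theorem conjQI_iQI : conjQI iQI = -iQI :=
  Subtype.ext (by rw [coe_conjQI]; simp [iQI])

theorem exists_of_conjQI_eq {z : QI} (h : conjQI z = z) : ∃ a : ℚ, algebraMap ℚ QI a = z := by
  obtain ⟨a, b, hz⟩ := exists_eq_add_mul_I z
  refine ⟨a, Subtype.ext ?_⟩
  have hb : b = 0 := by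
    have h' := congrArg Complex.im (congrArg (Subtype.val) h)
    rw [coe_conjQI, hz] at h'
    simp at h'
    have : (b : ℝ) = 0 := by linarith
    exact_mod_cast this
  rw [hz, hb]
  simp

end GaussianField

section Curve

variable {p : ℕ}

/-- The curve `y² = x³ + 20 p x`, which is isogenous to `y² = x³ - 5 p x`. -/
def dualCurve (p : ℕ) : WeierstrassCurve ℚ where
  a₁ := 0
  a₂ := 0
  a₃ := 0
  a₄ := 20 * (p : ℚ)
  a₆ := 0

theorem isShort_curve (hp : p ≠ 0) : IsShort (curve p) (-5 * (p : ℚ)) where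
  a₁ := rfl
  a₂ := rfl
  a₃ := rfl
  a₄ := rfl
  a₆ := rfl
  ne_zero := by simpa using hp

theorem isShort_dualCurve (hp : p ≠ 0) : IsShort (dualCurve p) (20 * (p : ℚ)) where
  a₁ := rfl
  a₂ := rfl
  a₃ := rfl
  a₄ := rfl
  a₆ := rfl
  ne_zero := by simpa using hp

/-- The curves over `ℚ` and `ℚ(i)` which enter the descent on `y² = x³ - 5 p x`. -/
noncomputable def pair (hp : p ≠ 0) : GaussianPair ℚ QI where
  f := algebraMap ℚ QI
  i := iQI
  i_sq := iQI_sq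
  b := -5 * (p : ℚ)
  W := curve p
  W' := dualCurve p
  V := (curve p).baseChange QI
  hW := isShort_curve hp
  hW' := by
    have := isShort_dualCurve hp
    rwa [show 20 * (p : ℚ) = -4 * (-5 * p) by ring] at this
  hV :=
    { a₁ := map_zero _
      a₂ := map_zero _
      a₃ := map_zero _
      a₄ := rfl
      a₆ := map_zero _
      ne_zero := (map_ne_zero _).2 (by simpa using hp) }

theorem finite_pointsQ (hp : p ≠ 0) : Module.Finite ℤ (PointsQ p) :=
  (pair hp).finite_points (b := -5 * p) (by simp [pair])

theorem finrank_pointsQI (hp : p ≠ 0) : Module.Finite ℤ (PointsQI p) ∧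
    finrank ℤ (PointsQI p) = 2 * finrank ℤ (PointsQ p) := by
  have : Module.Finite ℤ (pair hp).W.toAffine.Point := finite_pointsQ hp
  exact (pair hp).finrank_eq conjQI conjQI_conjQI conjQI_iQI
    (fun a => by simp [pair]) fun z hz => exists_of_conjQI_eq hz

theorem IsShort.squareLike_some {F : Type*} [Field F] {W : WeierstrassCurve F} {x y w : F}
    (hxy : W.toAffine.Nonsingular x y) (hx : x = w ^ 2) :
    IsShort.SquareLike (Point.some x y hxy) := by
  subst hx
  exact Or.inr ⟨w, y, hxy, rfl⟩

theorem squareLike_curve (hp : p.Prime) (h4 : p % 4 = 3) (h5 : p % 5 = 2 ∨ p % 5 = 3)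
    (P : PointsQ p) : ∃ s ∈ ({0, (isShort_curve hp.ne_zero).origin} : Set (PointsQ p)),
      IsShort.SquareLike (P - s) := by
  have hW := isShort_curve hp.ne_zero
  rcases P with _ | ⟨x, y, hxy⟩
  · exact ⟨0, by simp, Or.inl (sub_zero _)⟩
  by_cases hx : x = 0
  · exact ⟨0, by simp, by rw [sub_zero]; exact IsShort.squareLike_some hxy (w := 0) (by simp [hx])⟩
  obtain ⟨d, c, M, e, N, -, hdc, hMe, hM, he, hxd, hN⟩ :=
    exists_quartic (b := -5 * p) hx (by push_cast; exact hW.eq_of_nonsingular hxy)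
  rcases class_of_quartic hp h4 h5 hdc hMe hN with rfl | rfl
  · refine ⟨0, by simp, ?_⟩
    rw [sub_zero]
    exact IsShort.squareLike_some hxy (w := (M : ℚ) / e) (by rw [hxd]; simp)
  · refine ⟨hW.origin, by simp, ?_⟩
    obtain ⟨h', e'⟩ := hW.add_origin hxy hx
    rw [sub_eq_add_neg, neg_eq_of_add_eq_zero_left hW.origin_add_origin, e']
    have hM' : (M : ℚ) ≠ 0 := by exact_mod_cast hM
    have he' : (e : ℚ) ≠ 0 := by exact_mod_cast he
    have hp' : (p : ℚ) ≠ 0 := by exact_mod_cast hp.ne_zero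
    refine IsShort.squareLike_some h' (w := (e : ℚ) / M) ?_
    rw [hxd]
    push_cast
    field_simp

/-- Translation by `(0, 0)` multiplies classes by `20p`, that is by `5p`, so it pairs `5p` with 1
and `2p` with 10. -/
theorem squareLike_dualCurve (hp : p.Prime) (h4 : p % 4 = 3) (h5 : p % 5 = 2 ∨ p % 5 = 3)
    (Q : (dualCurve p).toAffine.Point) :
    (∃ s ∈ ({0, (isShort_dualCurve hp.ne_zero).origin} : Set (dualCurve p).toAffine.Point),
      IsShort.SquareLike (Q - s)) ∨
    (IsSquare (10 : ZMod p) ∧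
      ∃ s ∈ ({0, (isShort_dualCurve hp.ne_zero).origin} : Set (dualCurve p).toAffine.Point),
        ∃ x y h, ∃ z : ℚ, z ≠ 0 ∧ Q - s = Point.some x y h ∧ x = 10 * z ^ 2) := by
  have hW := isShort_dualCurve hp.ne_zero
  rcases Q with _ | ⟨x, y, hxy⟩
  · exact Or.inl ⟨0, by simp, Or.inl (sub_zero _)⟩
  by_cases hx : x = 0
  · exact Or.inl ⟨0, by simp, by
      rw [sub_zero]; exact IsShort.squareLike_some hxy (w := 0) (by simp [hx])⟩
  obtain ⟨d, c, M, e, N, hd, hdc, hMe, hM, he, hxd, hN⟩ :=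
    exists_quartic (b := 20 * p) hx (by push_cast; exact hW.eq_of_nonsingular hxy)
  obtain ⟨h', e'⟩ := hW.add_origin hxy hx
  have hsub : Point.some x y hxy - hW.origin = Point.some _ _ h' := by
    rw [sub_eq_add_neg, neg_eq_of_add_eq_zero_left hW.origin_add_origin, e']
  have hM' : (M : ℚ) ≠ 0 := by exact_mod_cast hM
  have he' : (e : ℚ) ≠ 0 := by exact_mod_cast he
  have hp' : (p : ℚ) ≠ 0 := by exact_mod_cast hp.ne_zero
  rcases class_of_quartic' hp h4 h5 hd hdc hMe hM hN with rfl | rfl | ⟨rfl | rfl, h10⟩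
  · refine Or.inl ⟨0, by simp, ?_⟩
    rw [sub_zero]
    exact IsShort.squareLike_some hxy (w := (M : ℚ) / e) (by rw [hxd]; simp)
  · refine Or.inl ⟨hW.origin, by simp, ?_⟩
    rw [hsub]
    refine IsShort.squareLike_some h' (w := 2 * ((e : ℚ) / M)) ?_
    rw [hxd]
    push_cast
    field_simp
    norm_num
  · exact Or.inr ⟨h10, 0, by simp, x, y, hxy, M / e, div_ne_zero hM' he', sub_zero _,
      by rw [hxd]; simp⟩
  · refine Or.inr ⟨h10, hW.origin, by simp, _, _, h', e / M, div_ne_zero he' hM', hsub, ?_⟩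
    rw [hxd]
    push_cast
    field_simp
    norm_num

theorem finrank_pointsQ_eq_zero (hp : p.Prime) (h8 : p % 8 = 7) (h5 : p % 5 = 2 ∨ p % 5 = 3) :
    finrank ℤ (PointsQ p) = 0 := by
  have : Module.Finite ℤ (pair hp.ne_zero).W.toAffine.Point := finite_pointsQ hp.ne_zero
  exact (pair hp.ne_zero).finrank_eq_zero_of_squareLike
    (squareLike_curve hp (by omega) h5) fun Q =>
      (squareLike_dualCurve hp (by omega) h5 Q).resolve_right
        fun h => not_isSquare_ten hp h8 h5 h.1

theorem finrank_pointsQ_le_one (hp : p.Prime) (h4 : p % 4 = 3) (h5 : p % 5 = 2 ∨ p % 5 = 3)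
    {y₀ : ℚ} (h₀ : (dualCurve p).toAffine.Nonsingular 10 y₀) :
    finrank ℤ (PointsQ p) ≤ 1 := by
  have : Module.Finite ℤ (pair hp.ne_zero).W.toAffine.Point := finite_pointsQ hp.ne_zero
  have hS' : ∀ Q : (dualCurve p).toAffine.Point,
      ∃ s ∈ ({0, (isShort_dualCurve hp.ne_zero).origin} : Set (dualCurve p).toAffine.Point),
        IsShort.SquareLike (Q - s) ∨ IsShort.SquareLike (Q - s - Point.some 10 y₀ h₀) := by
    intro Q
    rcases squareLike_dualCurve hp h4 h5 Q with ⟨s, hs, h⟩ | ⟨-, s, hs, x, y, h, z, hz, e, hx⟩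
    · exact ⟨s, hs, Or.inl h⟩
    · refine ⟨s, hs, Or.inr ?_⟩
      rw [e]
      exact (isShort_dualCurve hp.ne_zero).squareLike_sub (z := 10 * z) h h₀ (by simpa using hz)
        (by rw [hx]; ring)
  exact (pair hp.ne_zero).finrank_le_one_of_squareLike (.some 10 y₀ h₀)
    (squareLike_curve hp h4 h5) hS'

/-- Points from representations `p = 8 s² - 5`. -/
theorem finrank_pointsQ_eq_one (hp : p.Prime) (h4 : p % 4 = 3) (h5 : p % 5 = 2 ∨ p % 5 = 3)
    {s : ℤ} (hs : (p : ℤ) = 8 * s ^ 2 - 5) : finrank ℤ (PointsQ p) = 1 := by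
  have := finite_pointsQ hp.ne_zero
  have hW := isShort_curve hp.ne_zero
  have hsQ : (p : ℚ) = 8 * (s : ℚ) ^ 2 - 5 := by exact_mod_cast hs
  refine le_antisymm (finrank_pointsQ_le_one hp h4 h5 (y₀ := 40 * s)
    ((isShort_dualCurve hp.ne_zero).nonsingular (by rw [hsQ]; ring))) ?_
  have h₁ := hW.nonsingular (x := 4 * (s : ℚ) ^ 2) (y := 2 * s * (4 * (s : ℚ) ^ 2 - 5)) (by
    rw [hsQ]; ring)
  have hs0 : s ≠ 0 := by rintro rfl; simp at hs
  have hs5 : 4 * s ^ 2 - 5 ≠ 0 := by omega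
  have hy : 2 * (s : ℚ) * (4 * (s : ℚ) ^ 2 - 5) ≠ 0 :=
    mul_ne_zero (mul_ne_zero two_ne_zero (by exact_mod_cast hs0)) (by exact_mod_cast hs5)
  -- The point itself is integral; its double has `x` the square of an odd integer over a multiple
  -- of 4.
  obtain ⟨Y, h₂, e⟩ := hW.double h₁ hy
  refine one_le_finrank (x := Point.some _ _ h₁) fun hfin => ?_
  have hW' : IsShort (curve p) ((-5 * p : ℤ) : ℚ) := by push_cast; exact hW
  refine hW'.not_isOfFinAddOrder h₂ ?_ (e ▸ hfin.add hfin)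
  have hnum : (4 * (s : ℚ) ^ 2) ^ 2 - -5 * (p : ℚ) = ((16 * s ^ 4 + 5 * p : ℤ) : ℚ) := by
    push_cast; ring
  have hden : 2 * (2 * (s : ℚ) * (4 * (s : ℚ) ^ 2 - 5)) =
      ((2 ^ 2 * (s * (4 * s ^ 2 - 5)) : ℤ) : ℚ) := by
    push_cast; ring
  have hodd : ¬(2 : ℤ) ∣ 16 * s ^ 4 + 5 * p := by omega
  have hnum0 : 16 * s ^ 4 + 5 * (p : ℤ) ≠ 0 := fun h0 => hodd (by rw [h0]; exact dvd_zero _)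
  have hden0 : (2 : ℤ) ^ 2 * (s * (4 * s ^ 2 - 5)) ≠ 0 :=
    mul_ne_zero (by norm_num) (mul_ne_zero hs0 hs5)
  rw [hnum, hden, padicValRat.pow, padicValRat.div (by exact_mod_cast hnum0)
    (by exact_mod_cast hden0), padicValRat.of_int, padicValRat.of_int,
    padicValInt.eq_zero_of_not_dvd hodd]
  have : 2 ≤ padicValInt 2 (2 ^ 2 * (s * (4 * s ^ 2 - 5))) := by
    refine ((padicValInt_dvd_iff 2 _).1 ?_).resolve_left hden0
    exact_mod_cast dvd_mul_right _ _
  have : (2 : ℤ) ≤ (padicValInt 2 (2 ^ 2 * (s * (4 * s ^ 2 - 5))) : ℤ) := by exact_mod_cast this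
  rw [Nat.cast_zero, zero_sub, Nat.cast_ofNat]
  linarith

/-- Points from representations `4 p + 5 = s²`. -/
theorem one_le_finrank_pointsQ (hp : p.Prime) {s : ℤ} (hs : 4 * (p : ℤ) + 5 = s ^ 2) :
    1 ≤ finrank ℤ (PointsQ p) := by
  have := finite_pointsQ hp.ne_zero
  have hW := isShort_curve hp.ne_zero
  have hsQ : (p : ℚ) = ((s : ℚ) ^ 2 - 5) / 4 := by
    have : 4 * (p : ℚ) + 5 = (s : ℚ) ^ 2 := by exact_mod_cast hs
    linarith
  have h₁ := hW.nonsingular (x := (s : ℚ) ^ 2 / 2 ^ 2) (y := s * ((s : ℚ) ^ 2 - 10) / 8) (by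
    rw [hsQ]; ring)
  have hW' : IsShort (curve p) ((-5 * p : ℤ) : ℚ) := by push_cast; exact hW
  refine one_le_finrank (hW'.not_isOfFinAddOrder h₁ ?_)
  -- With `s` odd, `x = s²/4` is not 2-integral.
  have hodd : ¬(2 : ℤ) ∣ s := by
    rintro ⟨k, rfl⟩
    have : 4 * (p : ℤ) + 5 = 4 * k ^ 2 := by rw [hs]; ring
    omega
  have hs0 : (s : ℚ) ≠ 0 := by
    intro h0
    have h0 : s = 0 := by exact_mod_cast h0
    exact hodd (by rw [h0]; exact dvd_zero _)
  have hv2 : padicValRat 2 (2 : ℚ) = 1 := padicValRat.self (by norm_num)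
  rw [← div_pow, padicValRat.pow, padicValRat.div hs0 two_ne_zero, padicValRat.of_int,
    padicValInt.eq_zero_of_not_dvd hodd, hv2]
  norm_num

end Curve

end FiveP

theorem corollary3p2 (p : ℕ) (hp : p.Prime) (hodd : Odd p) :
    FiveP.quadraticTwist (FiveP.curve p) (-1) = FiveP.curve p ∧
    (∃ C : WeierstrassCurve.VariableChange FiveP.QI,
      C • (FiveP.curve p).baseChange FiveP.QI =
        (FiveP.quadraticTwist (FiveP.curve p) (-1)).baseChange FiveP.QI) ∧
    Module.Finite ℤ (FiveP.PointsQ p) ∧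
    Module.Finite ℤ (FiveP.PointsQI p) ∧
    Module.finrank ℤ (FiveP.PointsQI p) = 2 * Module.finrank ℤ (FiveP.PointsQ p) ∧
    (p ≡ 7 [MOD 40] ∨ p ≡ 23 [MOD 40] → Module.finrank ℤ (FiveP.PointsQI p) = 0) ∧
    ((∃ k₁ : ℤ, (p : ℤ) = 40 * k₁ + 3 ∧ IsSquare (5 * k₁ + 1)) ∨
      (∃ k₂ : ℤ, (p : ℤ) = 40 * k₂ + 27 ∧ IsSquare (5 * k₂ + 4)) →
        Module.finrank ℤ (FiveP.PointsQI p) = 2) ∧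
    ((∃ k₃ : ℤ, (p : ℤ) = 40 * k₃ + 11 ∧ IsSquare (160 * k₃ + 49)) ∨
      (∃ k₄ : ℤ, (p : ℤ) = 40 * k₄ + 19 ∧ IsSquare (160 * k₄ + 81)) →
        2 ≤ Module.finrank ℤ (FiveP.PointsQI p)) := by
  have htwist : FiveP.quadraticTwist (FiveP.curve p) (-1) = FiveP.curve p := by
    simp [FiveP.quadraticTwist, FiveP.curve, WeierstrassCurve.b₂, WeierstrassCurve.b₄,
      WeierstrassCurve.b₆]
    ring
  obtain ⟨hfin, hrank⟩ := FiveP.finrank_pointsQI hp.ne_zero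
  refine ⟨htwist, ⟨1, by rw [htwist, one_smul]⟩, FiveP.finite_pointsQ hp.ne_zero, hfin, hrank,
    ?_, ?_, ?_⟩
  · intro h
    have h' : p % 40 = 7 ∨ p % 40 = 23 := h
    rw [hrank, FiveP.finrank_pointsQ_eq_zero hp (by omega) (by omega)]
  · rintro (⟨k, hk, s, hs⟩ | ⟨k, hk, s, hs⟩)
    -- `8(5k + 1) - 5 = 40k + 3` and `8(5k + 4) - 5 = 40k + 27`.
    all_goals
      rw [hrank, FiveP.finrank_pointsQ_eq_one hp (by omega) (by omega) (s := s)
        (by rw [sq]; omega)]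
  · rintro (⟨k, hk, s, hs⟩ | ⟨k, hk, s, hs⟩)
    -- `4(40k + 11) + 5 = 160k + 49` and `4(40k + 19) + 5 = 160k + 81`.
    all_goals
      have := FiveP.one_le_finrank_pointsQ hp (s := s) (by rw [sq]; omega)
      omega
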